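/- Let $\mathbb{F}$ be either (a) a number field, or (b) a function field in one variable over a field $\mathbb{K}$, i.e. a finitely generated extension of $\mathbb{K}$ of transcendence degree one (for instance the field $\mathbb{K}(C)$ of rational functions on a smooth projective curve $C$ over $\mathbb{K}$). A norm on $\mathbb{F}$ is a nontrivial real-valued absolute value, archimedean or not; in case (b) only norms that are trivial on $\mathbb{K}$ are considered. Let $S$ be the set of equivalence classes of norms on $\mathbb{F}$, two norms being equivalent if they define the same topology, and choose a representative $|\cdot|_p$ of each class $p\in S$ (for example so that the product formula holds; the choice is arbitrary). For $p\in S$ let $\mathbb{F}_p$ be the completion of $\mathbb{F}$ with respect to $|\cdot|_p$, let $\overline{\mathbb{F}}_p$ be an algebraic closure of $\mathbb{F}_p$, and extend the norm to it by $|a|_p=|N_{L/\mathbb{F}_p}(a)|_p^{1/[L:\mathbb{F}_p]}$, where $L=\mathbb{F}_p(a)$. For a closed subscheme $X\subset\mathbb{G}_m^d$ over $\mathbb{F}$ put $$\mathscr{A}_p(X)=\overline{\{(\log|z_1|_p,\dots,\log|z_d|_p) : z\in X(\overline{\mathbb{F}}_p)\}}\subset\mathbb{R}^d,\qquad \mathscr{A}_{\mathbb{A}}(X)=\bigcup_{p\in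 S}\mathscr{A}_p(X).$$ Theorem. Let $X\subset\mathbb{G}_m^d$ be a hypersurface defined over $\mathbb{F}$, i.e. $X=\{f=0\}$ for a Laurent polynomial $f\in\mathbb{F}[x_1^{\pm1},\dots,x_d^{\pm1}]$ that is neither zero nor a unit (that is, not a monomial). Assume that $\mathbf{0}\notin\mathscr{A}_p(X)$ for at least one $p\in S$. Then for every nonzero vector $\mathbf{v}\in\mathbb{R}^d$ the open half-line $(0,\infty)\cdot\mathbf{v}$ meets $\mathscr{A}_{\mathbb{A}}(X)$. -/

import Mathlib

open scoped IntermediateField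

noncomputable section

namespace AdelicAmoeba

/-! ### Subschemes of the torus and amoebas over a normed field -/

/-- Laurent polynomials `∑ aₙ xⁿ` in `d` variables over `k`; the monomial `xⁿ` is
`AddMonoidAlgebra.single n 1`. -/
abbrev Laurent (k : Type*) [Field k] (d : ℕ) : Type _ := AddMonoidAlgebra k (Fin d → ℤ)

/-- The value of a Laurent polynomial over `k` at a point `z` of `(Lˣ)ᵈ`, where `L` is an
extension of `k`. -/
def Laurent.evalAt {k L : Type*} [Field k] [Field L] [Algebra k L] {d : ℕ}
    (f : Laurent k d) (z : Fin d → Lˣ) : L :=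
  f.coeff.sum fun n a => algebraMap k L a * ∏ i, ((z i ^ n i : Lˣ) : L)

/-- The `L`-points of the closed subscheme `Spec (k[x₁^±1, …, x_d^±1] / I)` of the torus. -/
def points {k : Type*} [Field k] (L : Type*) [Field L] [Algebra k L] {d : ℕ}
    (I : Ideal (Laurent k d)) : Set (Fin d → Lˣ) :=
  {z | ∀ f ∈ I, f.evalAt z = 0}

/-- A hypersurface `{f = 0}` in the torus: the subscheme defined by a single Laurent polynomial
that is neither zero nor a unit (the units being the monomials, which have no zeros in the
torus). -/
def IsHypersurface {k : Type*} [Field k] {d : ℕ} (I : Ideal (Laurent k d)) : Prop :=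
  ∃ f : Laurent k d, f ≠ 0 ∧ ¬ IsUnit f ∧ I = Ideal.span {f}

/-- The extension of the norm of `k` to its algebraic closure:
`|a| = |N_{L/k}(a)| ^ (1 / [L : k])` with `L = k(a)`. -/
def extNorm (k : Type*) [NormedField k] (a : AlgebraicClosure k) : ℝ :=
  ‖Algebra.norm k (IntermediateField.AdjoinSimple.gen k a)‖ ^ (1 / (Module.finrank k k⟮a⟯ : ℝ))

/-- The map `Log (a₁, …, a_d) = (log |a₁|, …, log |a_d|)`. -/
def logMap (k : Type*) [NormedField k] {d : ℕ} (z : Fin d → (AlgebraicClosure k)ˣ) :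
    Fin d → ℝ :=
  fun i => Real.log (extNorm k (z i : AlgebraicClosure k))

/-- The amoeba of a closed subscheme of the torus over a normed field `k`. -/
def amoeba (k : Type*) [NormedField k] {d : ℕ} (I : Ideal (Laurent k d)) : Set (Fin d → ℝ) :=
  closure (logMap k '' points (AlgebraicClosure k) I)

/-! ### Number fields, function fields and their places -/

/-- Either `F` is a number field, and then there are no constants, `C = ∅`; or `F` is a
function field in one variable over a subfield `K`, i.e. a finitely generated
extension of `K` of transcendence degree one, and then the set of constants is `C = K`. -/
def IsNumberOrFunctionField (F : Type*) [Field F] (C : Set F) : Prop :=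
  (NumberField F ∧ C = ∅) ∨
    ∃ K : Subfield F, C = (K : Set F) ∧ Algebra.EssFiniteType K F ∧ Algebra.trdeg K F = 1

/-- The nontrivial norms on `F` that induce the trivial norm on the constants `C`. -/
def Norms (F : Type*) [Field F] (C : Set F) : Type _ :=
  {v : AbsoluteValue F ℝ // v.IsNontrivial ∧ ∀ a ∈ C, a ≠ 0 → v a = 1}

/-- Equivalence of norms. For nontrivial norms on a field Mathlib's `AbsoluteValue.IsEquiv`
means that they define the same topology. -/
def normsSetoid (F : Type*) [Field F] (C : Set F) : Setoid (Norms F C) where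
  r v w := v.1.IsEquiv w.1
  iseqv := ⟨fun _ => .rfl, fun h => h.symm, fun h h' => h.trans h'⟩

/-- The set `S(F)` of equivalence classes of norms. -/
def Place (F : Type*) [Field F] (C : Set F) : Type _ := Quotient (normsSetoid F C)

/-- The class of a norm. -/
def Norms.place {F : Type*} [Field F] {C : Set F} (v : Norms F C) : Place F C :=
  Quotient.mk (normsSetoid F C) v

/-- The embedding of `F` into its completion with respect to `v`. -/
def toCompletion {F : Type*} [Field F] (v : AbsoluteValue F ℝ) : F →+* v.Completion :=
  (UniformSpace.Completion.coeRingHom (α := WithAbs v)).comp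
    (WithAbs.equiv v).symm.toRingHom

/-- The ideal of the subscheme of the torus over `F` defined by `I`, regarded
as a subscheme over the completion of `F` with respect to `v`. -/
def baseChange {F : Type*} [Field F] (v : AbsoluteValue F ℝ) {d : ℕ}
    (I : Ideal (Laurent F d)) : Ideal (Laurent v.Completion d) :=
  I.map (AddMonoidAlgebra.mapRingHom (Fin d → ℤ) (toCompletion v))

/-- The `v`-adic amoeba of a subscheme of the torus over `F`. -/
def amoebaAt {F : Type*} [Field F] (v : AbsoluteValue F ℝ) {d : ℕ}
    (I : Ideal (Laurent F d)) : Set (Fin d → ℝ) :=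
  amoeba v.Completion (baseChange v I)

/-- The adelic amoeba: the union of the amoebas over all places, where `rep p` is the chosen
norm in the class `p`. -/
def adelicAmoeba {F : Type*} [Field F] {C : Set F} (rep : Place F C → Norms F C) {d : ℕ}
    (I : Ideal (Laurent F d)) : Set (Fin d → ℝ) :=
  ⋃ p : Place F C, amoebaAt (rep p).1 I

end AdelicAmoeba

end

/-! Suppose the ray through `v` misses the amoeba at every place. A nonarchimedean amoeba contains
the corner locus of the tropical polynomial w ↦ max (log |aₙ| + ⟨n, w⟩)
(`mem_amoebaAt_of_max_attained_twice`). At a nonarchimedean place where all coefficients are units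
(`exists_norm_eq_one`), this forces ⟨n, v⟩ to be maximal at a single exponent. Dividing by that term
gives f = 1 + ∑ aₙ xⁿ with ⟨n, v⟩ < 0 for all n ≠ 0. At each nonarchimedean place the constant term
dominates far out on the ray and is never tied on it, so |aₙ| ≤ 1
(`apply_coeff_le_one_of_ray_disjoint`).

Over a function field, the place whose amoeba omits 0 yields a coefficient b with |b| < 1. Then b is
transcendental over the constants, so it has a pole at some other place, which contradicts |b| ≤ 1
there.

Over a number field, the aₙ are algebraic integers. At the complex embeddings, absence of zeros
spreads from the ray of `v` into the open cone ⟨n, ·⟩ < 0 (`ZeroFreeAt.add_direction`), and in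
particular to the ray of an integral vector m of this cone (`exists_integral_direction`). On the
one-parameter subgroup x ↦ xᵐ the equation is a polynomial in x⁻¹ with integral coefficients and
constant term 1. A solution x is therefore an algebraic integer, and absence of zeros keeps all its
conjugates in the closed unit disc. By Kronecker x is a root of unity (`exists_torsion_point`). The
hypersurface then has a torsion point, which puts 0 in the amoeba at every place
(`zero_mem_amoebaAt_of_torsion_point`), against the hypothesis. -/

noncomputable section

namespace AdelicAmoeba

open Polynomial IsDedekindDomain

/-- The value of the monomial `xⁿ` at the point `z` of a torus. -/
def monomialAt {L : Type*} [Field L] {d : ℕ} (z : Fin d → Lˣ) (n : Fin d → ℤ) : Lˣ :=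
  ∏ i, z i ^ n i

/-- The pairing between exponents and vectors of `ℝᵈ`. -/
def pairing {d : ℕ} (n : Fin d → ℤ) (w : Fin d → ℝ) : ℝ := ∑ i, (n i : ℝ) * w i

/-! ### Exponents, monomials and evaluation on the torus -/

section Pairing

variable {d : ℕ}

@[simp] lemma pairing_zero_left (w : Fin d → ℝ) : pairing 0 w = 0 := by simp [pairing]

@[simp] lemma pairing_zero_right (n : Fin d → ℤ) : pairing n 0 = 0 := by simp [pairing]

lemma pairing_add (n : Fin d → ℤ) (w w' : Fin d → ℝ) :
    pairing n (w + w') = pairing n w + pairing n w' := by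
  simp [pairing, mul_add, Finset.sum_add_distrib]

lemma pairing_smul (n : Fin d → ℤ) (t : ℝ) (w : Fin d → ℝ) :
    pairing n (t • w) = t * pairing n w := by
  simp only [pairing, Pi.smul_apply, smul_eq_mul, Finset.mul_sum]
  exact Finset.sum_congr rfl fun i _ => by ring

lemma pairing_sub_left (n n' : Fin d → ℤ) (w : Fin d → ℝ) :
    pairing (n - n') w = pairing n w - pairing n' w := by
  simp [pairing, sub_mul, Finset.sum_sub_distrib]

lemma pairing_intCast (n m : Fin d → ℤ) :
    pairing n (fun i => (m i : ℝ)) = ((n ⬝ᵥ m : ℤ) : ℝ) := by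
  simp [pairing, dotProduct]

lemma abs_pairing_le (n : Fin d → ℤ) (w : Fin d → ℝ) {ε : ℝ} (hw : ∀ i, |w i| ≤ ε) :
    |pairing n w| ≤ (∑ i, |(n i : ℝ)|) * ε := by
  rw [Finset.sum_mul]
  refine (Finset.abs_sum_le_sum_abs _ _).trans (Finset.sum_le_sum fun i _ => ?_)
  rw [abs_mul]
  exact mul_le_mul_of_nonneg_left (hw i) (abs_nonneg _)

end Pairing

section Monomials

variable {d : ℕ} {L : Type*} [Field L]

@[simp] lemma monomialAt_zero (z : Fin d → Lˣ) : monomialAt z 0 = 1 := by simp [monomialAt]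

lemma monomialAt_add (z : Fin d → Lˣ) (n n' : Fin d → ℤ) :
    monomialAt z (n + n') = monomialAt z n * monomialAt z n' := by
  simp [monomialAt, zpow_add, Finset.prod_mul_distrib]

lemma monomialAt_mul (z y : Fin d → Lˣ) (n : Fin d → ℤ) :
    monomialAt (z * y) n = monomialAt z n * monomialAt y n := by
  simp [monomialAt, mul_zpow, Finset.prod_mul_distrib]

lemma monomialAt_zpow (x : Lˣ) (m n : Fin d → ℤ) :
    monomialAt (fun i => x ^ m i) n = x ^ (n ⬝ᵥ m) := by
  simp only [monomialAt, dotProduct, ← zpow_mul, mul_comm (n _)]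
  induction (Finset.univ : Finset (Fin d)) using Finset.cons_induction with
  | empty => simp
  | cons i s hi ih => rw [Finset.prod_cons, Finset.sum_cons, zpow_add, ih]

lemma map_monomialAt {L' : Type*} [Field L'] (φ : L →+* L') (z : Fin d → Lˣ) (n : Fin d → ℤ) :
    φ (monomialAt z n : Lˣ) = (monomialAt (fun i => Units.map φ.toMonoidHom (z i)) n : L'ˣ) := by
  have : Units.map φ.toMonoidHom (monomialAt z n)
      = monomialAt (fun i => Units.map φ.toMonoidHom (z i)) n := by
    simp [monomialAt, map_prod, map_zpow]
  rw [← this]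
  rfl

lemma log_monomialAt (N : AbsoluteValue L ℝ) (z : Fin d → Lˣ) (n : Fin d → ℤ) :
    Real.log (N (monomialAt z n : Lˣ)) = pairing n (fun i => Real.log (N (z i : L))) := by
  have hz : ∀ i, N (z i : L) ≠ 0 := fun i => N.ne_zero (z i).ne_zero
  simp only [monomialAt, Units.coe_prod, map_prod, pairing]
  rw [Real.log_prod]
  · refine Finset.sum_congr rfl fun i _ => ?_
    rw [Units.val_zpow_eq_zpow_val, map_zpow₀, Real.log_zpow]
  · intro i _
    rw [Units.val_zpow_eq_zpow_val, map_zpow₀]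
    exact zpow_ne_zero _ (hz i)

end Monomials

section Evaluation

variable {d : ℕ} {k L : Type*} [Field k] [Field L] [Algebra k L]

lemma Laurent.evalAt_eq_sum (f : Laurent k d) (z : Fin d → Lˣ) :
    f.evalAt z = ∑ n ∈ f.coeff.support, algebraMap k L (f.coeff n) * (monomialAt z n : Lˣ) := by
  simp [Laurent.evalAt, Finsupp.sum, monomialAt, Units.coe_prod]

/-- Evaluation of Laurent polynomials at a point of the torus, as a ring homomorphism. -/
def evalHom (z : Fin d → Lˣ) : Laurent k d →ₐ[k] L :=
  AddMonoidAlgebra.lift k L (Fin d → ℤ)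
    { toFun := fun n => (monomialAt z n.toAdd : Lˣ)
      map_one' := by simp
      map_mul' := fun n n' => by simp [monomialAt_add] }

lemma evalHom_apply (f : Laurent k d) (z : Fin d → Lˣ) : evalHom z f = f.evalAt z := by
  simp [evalHom, AddMonoidAlgebra.lift_apply, Laurent.evalAt, Algebra.smul_def, monomialAt,
    Units.coe_prod]

lemma mem_points_span_singleton (f : Laurent k d) (z : Fin d → Lˣ) :
    z ∈ points L (Ideal.span {f}) ↔ f.evalAt z = 0 := by
  refine ⟨fun h => h f (Ideal.mem_span_singleton_self f), fun h g hg => ?_⟩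
  obtain ⟨q, rfl⟩ := Ideal.mem_span_singleton'.1 hg
  rw [← evalHom_apply, map_mul, evalHom_apply f, h, mul_zero]

lemma span_singleton_mul_unit (f u : Laurent k d) (hu : IsUnit u) :
    Ideal.span {u * f} = Ideal.span {f} :=
  Ideal.span_singleton_mul_left_unit hu f

lemma isUnit_single (n : Fin d → ℤ) {a : k} (ha : a ≠ 0) :
    IsUnit (AddMonoidAlgebra.single n a : Laurent k d) := by
  refine IsUnit.of_mul_eq_one (AddMonoidAlgebra.single (-n) a⁻¹) ?_
  simp [AddMonoidAlgebra.single_mul_single, ha, AddMonoidAlgebra.one_def]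

lemma logMap_mem_amoebaAt {F : Type*} [Field F] (v : AbsoluteValue F ℝ) (f : Laurent F d)
    (z : Fin d → (AlgebraicClosure v.Completion)ˣ)
    (hz : ∑ n ∈ f.coeff.support,
      algebraMap v.Completion (AlgebraicClosure v.Completion) (toCompletion v (f.coeff n)) *
        (monomialAt z n : (AlgebraicClosure v.Completion)ˣ) = 0) :
    logMap v.Completion z ∈ amoebaAt v (Ideal.span {f}) := by
  refine subset_closure ⟨z, ?_, rfl⟩
  rw [baseChange, Ideal.map_span, Set.image_singleton, mem_points_span_singleton,
    Laurent.evalAt_eq_sum, ← hz]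
  have : (AddMonoidAlgebra.mapRingHom (Fin d → ℤ) (toCompletion v) f).coeff.support
      = f.coeff.support := by
    ext n
    simp
  rw [this]
  simp

end Evaluation

section ExtNorm

variable (k : Type*) [NormedField k]

/-- This is the form that can be compared with the spectral norm in the nonarchimedean case and with
a product of complex conjugates in the archimedean case. -/
lemma extNorm_eq_coeff_zero (a : AlgebraicClosure k) :
    extNorm k a = ‖(minpoly k a).coeff 0‖ ^ (1 / ((minpoly k a).natDegree : ℝ)) := by
  have ha : IsIntegral k a := Algebra.IsIntegral.isIntegral a
  have h := Algebra.PowerBasis.norm_gen_eq_coeff_zero_minpoly (IntermediateField.adjoin.powerBasis ha)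
  rw [IntermediateField.adjoin.powerBasis_gen, IntermediateField.minpoly_gen] at h
  rw [extNorm, h, IntermediateField.adjoin.finrank ha]
  simp

end ExtNorm

/-- There is an integral direction in which finitely many exponents have distinct degrees. -/
lemma exists_injOn_dotProduct {d : ℕ} (S : Finset (Fin d → ℤ)) :
    ∃ m : Fin d → ℤ, Set.InjOn (fun n : Fin d → ℤ => n ⬝ᵥ m) S := by
  classical
  -- The direction is (1, B, B², …): distinct exponents give distinct polynomials in B, and some B
  -- avoids the zeros of all their differences.
  let p : (Fin d → ℤ) → ℤ[X] := fun n => ∑ i, C (n i) * X ^ (i : ℕ)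
  have hp : ∀ n n', p n = p n' → n = n' := by
    intro n n' h
    funext j
    have := congrArg (fun q => q.coeff (j : ℕ)) h
    simpa [p, Polynomial.finsetSum_coeff, Polynomial.coeff_C_mul, Polynomial.coeff_X_pow,
      Fin.val_inj] using this
  let q : ℤ[X] := ∏ x ∈ S.offDiag, (p x.1 - p x.2)
  have hq : q ≠ 0 := Finset.prod_ne_zero_iff.2 fun x hx =>
    sub_ne_zero.2 fun h => (Finset.mem_offDiag.1 hx).2.2 (hp _ _ h)
  obtain ⟨B, hB⟩ : ∃ B, q.eval B ≠ 0 := by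
    by_contra! h
    exact hq (Polynomial.funext fun B => by simpa using h B)
  refine ⟨fun i => B ^ (i : ℕ), fun n hn n' hn' h => ?_⟩
  by_contra hne
  refine hB ?_
  rw [eval_prod]
  refine Finset.prod_eq_zero (i := (n, n')) (Finset.mem_offDiag.2 ⟨hn, hn', hne⟩) ?_
  simpa [p, eval_finsetSum, dotProduct, sub_eq_zero] using h

/-- The polynomial in one variable with coefficient `b n` in degree `e n`. -/
def sumMonomials {ι L : Type*} [Field L] (S : Finset ι) (b : ι → L) (e : ι → ℕ) : L[X] :=
  ∑ n ∈ S, C (b n) * X ^ e n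

section SumMonomials

variable {ι L : Type*} [Field L] (S : Finset ι) (b : ι → L) (e : ι → ℕ)

lemma eval_sumMonomials (x : L) : (sumMonomials S b e).eval x = ∑ n ∈ S, b n * x ^ e n := by
  simp [sumMonomials, eval_finsetSum]

lemma coeff_sumMonomials (he : Set.InjOn e S) {n : ι} (hn : n ∈ S) :
    (sumMonomials S b e).coeff (e n) = b n := by
  classical
  rw [sumMonomials, finsetSum_coeff, Finset.sum_eq_single n]
  · simp
  · intro n' hn' hne
    rw [coeff_C_mul, coeff_X_pow, if_neg fun h => hne (he hn' hn h.symm), mul_zero]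
  · exact fun h => absurd hn h

lemma exists_of_coeff_sumMonomials_ne_zero {k : ℕ} (hk : (sumMonomials S b e).coeff k ≠ 0) :
    ∃ n ∈ S, e n = k := by
  by_contra! h
  refine hk ?_
  rw [sumMonomials, finsetSum_coeff]
  exact Finset.sum_eq_zero fun n hn => by rw [coeff_C_mul, coeff_X_pow, if_neg (h n hn).symm, mul_zero]

end SumMonomials

/-! ### Nonarchimedean zeros and the tropical corner locus -/

section Nonarchimedean

variable {E : Type*} [Field E] (N : AbsoluteValue E ℝ)

lemma gaussNorm_X_sub_C (x : E) {c : ℝ} (hc : 0 < c) :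
    (X - C x : E[X]).gaussNorm N c = max c (N x) := by
  refine le_antisymm ?_ (max_le ?_ ?_)
  · obtain ⟨i, hi⟩ := exists_eq_gaussNorm N c (X - C x : E[X])
    rw [hi]
    rcases i with _ | _ | i
    · simp
    · simp [coeff_X]
    · simp [coeff_X, hc.le]
  · refine le_trans (le_of_eq ?_) (le_gaussNorm N (X - C x : E[X]) hc.le 1)
    simp [coeff_X]
  · refine le_trans (le_of_eq ?_) (le_gaussNorm N (X - C x : E[X]) hc.le 0)
    simp

variable {N}

/-- The Gauss norm is multiplicative, and that of X - x at radius ρ is max(ρ, |x|), whose logarithm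
is affine in log ρ away from |x|. With no root in the open annulus, the value at log ρ = 0 is the
mean of the values at ± log c. -/
lemma gaussNorm_mul_gaussNorm_inv (hN : IsNonarchimedean N) [IsAlgClosed E] (P : E[X])
    {c : ℝ} (hc : 1 ≤ c) (hroots : ∀ x ∈ P.roots, N x ≤ c⁻¹ ∨ c ≤ N x) :
    P.gaussNorm N c * P.gaussNorm N c⁻¹ = P.gaussNorm N 1 ^ 2 := by
  have hc0 : 0 < c := one_pos.trans_le hc
  have hci : c⁻¹ ≤ 1 := inv_le_one_of_one_le₀ hc
  have key : ∀ s : Multiset E, (∀ x ∈ s, N x ≤ c⁻¹ ∨ c ≤ N x) →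
      ((s.map fun x => X - C x).prod).gaussNorm N c * ((s.map fun x => X - C x).prod).gaussNorm N c⁻¹
        = ((s.map fun x => X - C x).prod).gaussNorm N 1 ^ 2 := by
    intro s
    induction s using Multiset.induction_on with
    | empty =>
      intro _
      simp only [Multiset.map_zero, Multiset.prod_zero, ← C_1, gaussNorm_C]
      simp
    | cons x s ih =>
      intro h
      have hx : max c (N x) * max c⁻¹ (N x) = max 1 (N x) ^ 2 := by
        rcases h x (Multiset.mem_cons_self x s) with h1 | h1
        · rw [max_eq_left (h1.trans (hci.trans hc)), max_eq_left h1, max_eq_left (h1.trans hci),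
            mul_inv_cancel₀ hc0.ne', one_pow]
        · rw [max_eq_right h1, max_eq_right ((hci.trans hc).trans h1), max_eq_right (hc.trans h1), sq]
      have ih' := ih fun y hy => h y (Multiset.mem_cons_of_mem hy)
      simp only [Multiset.map_cons, Multiset.prod_cons]
      rw [gaussNorm_mul hN hc0, gaussNorm_mul hN (inv_pos.2 hc0), gaussNorm_mul hN one_pos,
        gaussNorm_X_sub_C N x hc0, gaussNorm_X_sub_C N x (inv_pos.2 hc0),
        gaussNorm_X_sub_C N x one_pos, mul_pow, ← hx, ← ih']
      ring
  have hs := key P.roots hroots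
  rw [(IsAlgClosed.splits P).eq_prod_roots, gaussNorm_mul hN hc0, gaussNorm_mul hN (inv_pos.2 hc0),
    gaussNorm_mul hN one_pos, gaussNorm_C, gaussNorm_C, gaussNorm_C, mul_pow, ← hs]
  ring

/-- If two coefficients of a polynomial are almost maximal in norm, then it has a root of norm
close to `1`. -/
lemma exists_root_abs_log_lt (hN : IsNonarchimedean N) [IsAlgClosed E] (P : E[X]) {i j : ℕ}
    (hij : i < j) {M η δ : ℝ} (hM : ∀ k, P.coeff k ≠ 0 → Real.log (N (P.coeff k)) ≤ M)
    (hi : P.coeff i ≠ 0) (hj : P.coeff j ≠ 0) (hi' : M - η ≤ Real.log (N (P.coeff i)))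
    (hj' : M - η ≤ Real.log (N (P.coeff j))) (hδ : 0 < δ) (hηδ : 4 * η < δ) :
    ∃ x, x ≠ 0 ∧ P.eval x = 0 ∧ |Real.log (N x)| < δ := by
  by_contra! hroot
  -- Without the desired root, the annulus between c⁻¹ and c contains no root. Bounding the Gauss
  -- norm below by the term j at c and by the term i at c⁻¹ gains (j - i)δ/2, which exceeds the loss
  -- 2η.
  set c := Real.exp (δ / 2) with hc
  have hc0 : 0 < c := Real.exp_pos _
  have hcinv : c⁻¹ = Real.exp (-(δ / 2)) := by rw [hc, Real.exp_neg]
  have hc1 : 1 ≤ c := Real.one_le_exp (by positivity)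
  have heq := gaussNorm_mul_gaussNorm_inv hN P hc1 fun x hx => by
    by_cases hx0 : x = 0
    · left
      simp [hx0, hc0.le]
    have hNx : 0 < N x := N.pos hx0
    have h := hroot x hx0 (isRoot_of_mem_roots hx)
    rcases le_abs'.1 h with h1 | h1
    · left
      rw [hcinv, ← Real.log_le_iff_le_exp hNx]
      linarith
    · right
      rw [hc, ← Real.le_log_iff_exp_le hNx]
      linarith
  have h1 : P.gaussNorm N 1 ≤ Real.exp M := by
    obtain ⟨k, hk⟩ := exists_eq_gaussNorm N 1 P
    rw [hk, one_pow, mul_one]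
    by_cases h0 : P.coeff k = 0
    · simp [h0, Real.exp_nonneg]
    · exact (Real.log_le_iff_le_exp (N.pos h0)).1 (hM k h0)
  have h10 : 0 ≤ P.gaussNorm N 1 := gaussNorm_nonneg N P zero_le_one
  have h2 : Real.exp (M - η + j * (δ / 2)) ≤ P.gaussNorm N c := by
    refine le_trans ?_ (le_gaussNorm N P hc0.le j)
    rw [Real.exp_add, hc, ← Real.exp_nat_mul]
    gcongr
    exact (Real.le_log_iff_exp_le (N.pos hj)).1 hj'
  have h3 : Real.exp (M - η - i * (δ / 2)) ≤ P.gaussNorm N c⁻¹ := by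
    refine le_trans ?_ (le_gaussNorm N P (inv_pos.2 hc0).le i)
    rw [sub_eq_add_neg, Real.exp_add, hcinv, ← Real.exp_nat_mul, mul_neg]
    gcongr
    exact (Real.le_log_iff_exp_le (N.pos hi)).1 hi'
  have h4 : Real.exp ((M - η + j * (δ / 2)) + (M - η - i * (δ / 2))) ≤ Real.exp (M + M) := by
    rw [Real.exp_add, Real.exp_add M M]
    calc _ ≤ P.gaussNorm N c * P.gaussNorm N c⁻¹ :=
          mul_le_mul h2 h3 (Real.exp_nonneg _) ((Real.exp_nonneg _).trans h2)
      _ = P.gaussNorm N 1 * P.gaussNorm N 1 := by rw [heq, sq]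
      _ ≤ _ := mul_le_mul h1 h1 h10 (Real.exp_nonneg _)
  have h5 := Real.exp_le_exp.1 h4
  have h6 : (i : ℝ) + 1 ≤ j := by exact_mod_cast hij
  nlinarith

/-- The integral powers of a k-th root of `π`, with k large, have logarithms spaced by at most `ε`.
-/
lemma exists_abs_log_sub_le [IsAlgClosed E] {π : E} (hπ : 1 < N π) (t : ℝ) {ε : ℝ} (hε : 0 < ε) :
    ∃ c : Eˣ, |Real.log (N (c : E)) - t| ≤ ε := by
  have hl : 0 < Real.log (N π) := Real.log_pos hπ
  obtain ⟨k, hk⟩ := exists_nat_gt (Real.log (N π) / ε)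
  have hk0 : 0 < (k : ℝ) := (div_pos hl hε).trans hk
  obtain ⟨y, hy⟩ := IsAlgClosed.exists_pow_nat_eq π (n := k) (by exact_mod_cast hk0)
  have hy0 : y ≠ 0 := by
    rintro rfl
    rw [zero_pow (by exact_mod_cast hk0.ne')] at hy
    simp [← hy] at hπ
    linarith
  set l := Real.log (N y) with hldef
  have hly : k * l = Real.log (N π) := by rw [← hy, map_pow, Real.log_pow]
  have hl0 : 0 < l := by
    by_contra! h
    nlinarith
  have hlε : l ≤ ε := by
    rw [div_lt_iff₀ hε] at hk
    nlinarith
  refine ⟨Units.mk0 y hy0 ^ ⌊t / l⌋, ?_⟩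
  rw [Units.val_zpow_eq_zpow_val, Units.val_mk0, map_zpow₀, Real.log_zpow, ← hldef]
  have h1 := Int.floor_le (t / l)
  have h2 := Int.lt_floor_add_one (t / l)
  rw [le_div_iff₀ hl0] at h1
  rw [div_lt_iff₀ hl0] at h2
  rw [abs_le]
  constructor <;> nlinarith

/-- Nonarchimedean hypersurfaces have points near every point where the tropical polynomial attains
its maximum twice. -/
lemma exists_zero_near_of_max_attained_twice (hN : IsNonarchimedean N) [IsAlgClosed E] {π : E}
    (hπ : 1 < N π) {d : ℕ} (S : Finset (Fin d → ℤ)) (a : (Fin d → ℤ) → E)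
    (ha : ∀ n ∈ S, a n ≠ 0) (w : Fin d → ℝ) (M : ℝ)
    (hM : ∀ n ∈ S, Real.log (N (a n)) + pairing n w ≤ M) {n₀ n₁ : Fin d → ℤ} (hn₀ : n₀ ∈ S)
    (hn₁ : n₁ ∈ S) (hne : n₀ ≠ n₁) (h₀ : Real.log (N (a n₀)) + pairing n₀ w = M)
    (h₁ : Real.log (N (a n₁)) + pairing n₁ w = M) {ε : ℝ} (hε : 0 < ε) :
    ∃ z : Fin d → Eˣ, ∑ n ∈ S, a n * (monomialAt z n : Eˣ) = 0 ∧
      ∀ i, |Real.log (N (z i : E)) - w i| ≤ ε := by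
  obtain ⟨m, hm⟩ := exists_injOn_dotProduct S
  set K : ℝ := 1 + ∑ n ∈ S, ∑ i, |(n i : ℝ)| with hK
  have hK0 : 0 < K := by positivity
  have hKn : ∀ n ∈ S, ∑ i, |(n i : ℝ)| ≤ K := fun n hn => by
    have := Finset.single_le_sum (f := fun n : Fin d → ℤ => ∑ i, |(n i : ℝ)|)
      (fun n _ => Finset.sum_nonneg fun i _ => abs_nonneg _) hn
    linarith
  set Km : ℝ := 1 + ∑ i, |(m i : ℝ)| with hKm
  have hKm0 : 0 < Km := by positivity
  have hKmi : ∀ i, |(m i : ℝ)| ≤ Km := fun i => by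
    have := Finset.single_le_sum (f := fun i => |(m i : ℝ)|) (fun i _ => abs_nonneg _)
      (Finset.mem_univ i)
    linarith
  -- The final factor xᵐ moves each coordinate by at most Km δ = ε/2. Replacing `w` by the
  -- logarithms of `c` costs at most K ε' per term, so the root lemma is used with η = 2Kε'; the 9
  -- ensures 4η < δ.
  set δ : ℝ := ε / (2 * Km) with hδ
  have hδ0 : 0 < δ := by positivity
  set ε' : ℝ := min (ε / 2) (δ / (9 * K)) with hε'
  have hε'0 : 0 < ε' := lt_min (by positivity) (by positivity)
  have hε'K : 9 * (K * ε') ≤ δ := by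
    have := min_le_right (ε / 2) (δ / (9 * K))
    rw [← hε', le_div_iff₀ (by positivity)] at this
    linarith
  choose c hc using fun i => exists_abs_log_sub_le hπ (w i) hε'0
  have hcn : ∀ n ∈ S, |Real.log (N (a n * (monomialAt c n : Eˣ)))
      - (Real.log (N (a n)) + pairing n w)| ≤ K * ε' := by
    intro n hn
    rw [map_mul, Real.log_mul (N.ne_zero (ha n hn)) (N.ne_zero (Units.ne_zero _)),
      log_monomialAt]
    have : pairing n (fun i => Real.log (N (c i : E))) = pairing n w
        + pairing n (fun i => Real.log (N (c i : E)) - w i) := by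
      rw [← pairing_add]
      congr 1
      funext i
      simp
    rw [this, add_sub_add_left_eq_sub, add_sub_cancel_left]
    exact (abs_pairing_le n _ hc).trans (mul_le_mul_of_nonneg_right (hKn n hn) hε'0.le)
  -- Multiplying by x^A makes all exponents of x nonnegative.
  obtain ⟨A, hA⟩ : ∃ A : ℕ, ∀ n ∈ S, 0 ≤ n ⬝ᵥ m + A := by
    refine ⟨∑ n ∈ S, (n ⬝ᵥ m).natAbs, fun n hn => ?_⟩
    have := Finset.single_le_sum (f := fun n : Fin d → ℤ => (n ⬝ᵥ m).natAbs)
      (fun n _ => Nat.zero_le _) hn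
    omega
  set e : (Fin d → ℤ) → ℕ := fun n => (n ⬝ᵥ m + A).toNat with he
  have heS : ∀ n ∈ S, (e n : ℤ) = n ⬝ᵥ m + A := fun n hn => Int.toNat_of_nonneg (hA n hn)
  have hinj : Set.InjOn e S := fun n hn n' hn' h => hm hn hn' (by
    have h1 := heS n hn
    have h2 := heS n' hn'
    simp only at h ⊢
    rw [h] at h1
    omega)
  set b : (Fin d → ℤ) → E := fun n => a n * (monomialAt c n : Eˣ) with hb
  have hb0 : ∀ n ∈ S, b n ≠ 0 := fun n hn => mul_ne_zero (ha n hn) (Units.ne_zero _)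
  set P := sumMonomials S b e with hP
  have hroot : ∃ x, x ≠ 0 ∧ P.eval x = 0 ∧ |Real.log (N x)| < δ := by
    have hbound : ∀ k, P.coeff k ≠ 0 → Real.log (N (P.coeff k)) ≤ M + K * ε' := by
      intro k hk
      obtain ⟨n, hn, rfl⟩ := exists_of_coeff_sumMonomials_ne_zero S b e hk
      rw [hP, coeff_sumMonomials S b e hinj hn]
      have := (abs_le.1 (hcn n hn)).2
      have := hM n hn
      linarith
    have hlow : ∀ n ∈ S, Real.log (N (a n)) + pairing n w = M →
        M + K * ε' - 2 * (K * ε') ≤ Real.log (N (P.coeff (e n))) := by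
      intro n hn h
      rw [hP, coeff_sumMonomials S b e hinj hn]
      have := (abs_le.1 (hcn n hn)).1
      linarith
    have hne0 : ∀ n ∈ S, P.coeff (e n) ≠ 0 := fun n hn => by
      rw [hP, coeff_sumMonomials S b e hinj hn]
      exact hb0 n hn
    have hKε : 0 < K * ε' := by positivity
    rcases lt_or_gt_of_ne (fun h => hne (hinj hn₀ hn₁ h)) with h | h
    · exact exists_root_abs_log_lt hN P h hbound (hne0 _ hn₀) (hne0 _ hn₁) (hlow _ hn₀ h₀)
        (hlow _ hn₁ h₁) hδ0 (by linarith)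
    · exact exists_root_abs_log_lt hN P h hbound (hne0 _ hn₁) (hne0 _ hn₀) (hlow _ hn₁ h₁)
        (hlow _ hn₀ h₀) hδ0 (by linarith)
  obtain ⟨x, hx0, hx, hxδ⟩ := hroot
  refine ⟨c * fun i => Units.mk0 x hx0 ^ m i, ?_, fun i => ?_⟩
  · rw [hP, eval_sumMonomials] at hx
    have : x ^ A * ∑ n ∈ S, a n * (monomialAt (c * fun i => Units.mk0 x hx0 ^ m i) n : Eˣ) = 0 := by
      rw [← hx, Finset.mul_sum]
      refine Finset.sum_congr rfl fun n hn => ?_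
      rw [monomialAt_mul, monomialAt_zpow, hb, Units.val_mul, Units.val_zpow_eq_zpow_val,
        Units.val_mk0, ← zpow_natCast x (e n), heS n hn, zpow_add₀ hx0, zpow_natCast]
      ring
    exact (mul_eq_zero.1 this).resolve_left (pow_ne_zero _ hx0)
  · rw [Pi.mul_apply, Units.val_mul, Units.val_zpow_eq_zpow_val, Units.val_mk0, map_mul, map_zpow₀,
      Real.log_mul (N.ne_zero (Units.ne_zero _)) (zpow_ne_zero _ (N.ne_zero hx0)), Real.log_zpow,
      add_sub_right_comm]
    refine (abs_add_le _ _).trans ?_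
    have h1 := (hc i).trans (min_le_left _ _)
    have h2 : |(m i : ℝ) * Real.log (N x)| ≤ ε / 2 := by
      rw [abs_mul]
      calc _ ≤ Km * δ := mul_le_mul (hKmi i) hxδ.le (abs_nonneg _) hKm0.le
        _ = ε / 2 := by
          rw [hδ]
          field_simp
    linarith

end Nonarchimedean

/-- Over a complete nonarchimedean field, `extNorm` is an absolute value. -/
lemma exists_absoluteValue_eq_extNorm (k : Type*) [NormedField k] [CompleteSpace k]
    [IsUltrametricDist k] (hk : ∃ x : k, 1 < ‖x‖) :
    ∃ N : AbsoluteValue (AlgebraicClosure k) ℝ, IsNonarchimedean N ∧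
      (∀ x : k, N (algebraMap k _ x) = ‖x‖) ∧ ∀ a, N a = extNorm k a := by
  let _ : NontriviallyNormedField k := { (inferInstance : NormedField k) with non_trivial := hk }
  let ν := spectralMulAlgNorm k (AlgebraicClosure k)
  refine ⟨⟨⟨ν, map_mul ν⟩, fun x => apply_nonneg ν x, fun x => map_eq_zero_iff_eq_zero ν,
    fun x y => map_add_le_add ν x y⟩, ?_, fun x => ?_, fun a => ?_⟩
  · exact isNonarchimedean_spectralNorm (K := k) (L := AlgebraicClosure k)
  · exact spectralNorm_extends (K := k) (L := AlgebraicClosure k) x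
  · rw [extNorm_eq_coeff_zero]
    exact spectralNorm.spectralNorm_eq_norm_coeff_zero_rpow k (AlgebraicClosure k) a

/-! ### Completions, nonarchimedean amoebas and torsion points -/

section Completion

variable {F : Type*} [Field F] (v : AbsoluteValue F ℝ)

lemma norm_toCompletion (x : F) : ‖toCompletion v x‖ = v x :=
  UniformSpace.Completion.norm_coe (E := WithAbs v) _

lemma exists_one_lt_norm_completion {v : AbsoluteValue F ℝ} (hv : v.IsNontrivial) :
    ∃ x : v.Completion, 1 < ‖x‖ := by
  obtain ⟨x, hx⟩ := hv.exists_abv_gt_one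
  exact ⟨toCompletion v x, by rwa [norm_toCompletion]⟩

lemma isUltrametricDist_completion {v : AbsoluteValue F ℝ} (hv : IsNonarchimedean v) :
    IsUltrametricDist v.Completion := by
  refine IsUltrametricDist.isUltrametricDist_of_isNonarchimedean_norm fun x y => ?_
  induction x, y using UniformSpace.Completion.induction_on₂ with
  | hp => exact isClosed_le (by fun_prop) (by fun_prop)
  | ih x y =>
    rw [← UniformSpace.Completion.coe_add, UniformSpace.Completion.norm_coe,
      UniformSpace.Completion.norm_coe, UniformSpace.Completion.norm_coe]
    exact hv x.ofAbs y.ofAbs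

/-- A nonarchimedean absolute value on `F` extends to the algebraic closure of the completion. -/
lemma exists_absoluteValue_algebraicClosure_completion {v : AbsoluteValue F ℝ}
    (hv : IsNonarchimedean v) (hv' : v.IsNontrivial) :
    ∃ N : AbsoluteValue (AlgebraicClosure v.Completion) ℝ, IsNonarchimedean N ∧
      (∀ x : F, N (algebraMap v.Completion _ (toCompletion v x)) = v x) ∧
      ∀ a, N a = extNorm v.Completion a := by
  have := isUltrametricDist_completion hv
  obtain ⟨N, hN, hN', hN''⟩ :=
    exists_absoluteValue_eq_extNorm v.Completion (exists_one_lt_norm_completion hv')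
  exact ⟨N, hN, fun x => by rw [hN', norm_toCompletion], hN''⟩

/-- A nonarchimedean amoeba of a hypersurface contains the corner locus of the tropical
polynomial. -/
lemma mem_amoebaAt_of_max_attained_twice {v : AbsoluteValue F ℝ} (hv : IsNonarchimedean v)
    (hv' : v.IsNontrivial) {d : ℕ} (f : Laurent F d) (w : Fin d → ℝ) (M : ℝ)
    (hM : ∀ n ∈ f.coeff.support, Real.log (v (f.coeff n)) + pairing n w ≤ M)
    {n₀ n₁ : Fin d → ℤ} (hn₀ : n₀ ∈ f.coeff.support) (hn₁ : n₁ ∈ f.coeff.support) (hne : n₀ ≠ n₁)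
    (h₀ : Real.log (v (f.coeff n₀)) + pairing n₀ w = M)
    (h₁ : Real.log (v (f.coeff n₁)) + pairing n₁ w = M) :
    w ∈ amoebaAt v (Ideal.span {f}) := by
  obtain ⟨N, hN, hNv, hNe⟩ := exists_absoluteValue_algebraicClosure_completion hv hv'
  obtain ⟨x, hx⟩ := hv'.exists_abv_gt_one
  -- The amoeba is closed, so approximating `w` by its points suffices.
  rw [amoebaAt, amoeba, ← closure_closure, Metric.mem_closure_iff]
  intro ε hε
  obtain ⟨z, hz, hzw⟩ := exists_zero_near_of_max_attained_twice hN (by rwa [hNv x])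
    f.coeff.support
    (fun n => algebraMap v.Completion (AlgebraicClosure v.Completion) (toCompletion v (f.coeff n)))
    (fun n hn => by simpa using hn) w M (fun n hn => by rw [hNv]; exact hM n hn) hn₀ hn₁ hne
    (by rw [hNv]; exact h₀) (by rw [hNv]; exact h₁) (half_pos hε)
  refine ⟨_, logMap_mem_amoebaAt v f z hz, ?_⟩
  rw [dist_comm]
  refine lt_of_le_of_lt ((dist_pi_le_iff (half_pos hε).le).2 fun i => ?_) (half_lt_self hε)
  rw [Real.dist_eq, logMap, ← hNe]
  exact hzw i

/-- The origin lies in the amoeba of a hypersurface which contains a torsion point. -/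
lemma zero_mem_amoebaAt_of_torsion_point {d : ℕ} (f : Laurent F d)
    (z : Fin d → (AlgebraicClosure F)ˣ)
    (hz : ∑ n ∈ f.coeff.support, algebraMap F (AlgebraicClosure F) (f.coeff n) *
      (monomialAt z n : (AlgebraicClosure F)ˣ) = 0)
    (htors : ∀ i, ∃ k : ℕ, 0 < k ∧ z i ^ k = 1) :
    0 ∈ amoebaAt v (Ideal.span {f}) := by
  let _ : Algebra F (AlgebraicClosure v.Completion) :=
    ((algebraMap v.Completion (AlgebraicClosure v.Completion)).comp (toCompletion v)).toAlgebra
  let φ : AlgebraicClosure F →ₐ[F] AlgebraicClosure v.Completion := IsAlgClosed.lift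
  have h := logMap_mem_amoebaAt v f (fun i => Units.map (φ : _ →+* _).toMonoidHom (z i)) (by
    have h := congrArg φ hz
    rw [map_sum, map_zero] at h
    rw [← h]
    refine Finset.sum_congr rfl fun n _ => ?_
    rw [← map_monomialAt, map_mul, AlgHom.commutes]
    rfl)
  convert h using 1
  funext i
  obtain ⟨k, hk, hzk⟩ := htors i
  -- Only multiplicativity of the field norm is used, so archimedean and nonarchimedean places need
  -- no distinction.
  have hone : ∀ a : AlgebraicClosure v.Completion, a ^ k = 1 → extNorm v.Completion a = 1 := by
    intro a ha
    have h1 : IntermediateField.AdjoinSimple.gen v.Completion a ^ k = 1 := by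
      apply Subtype.ext
      simpa using ha
    have h2 := congrArg (fun y => ‖Algebra.norm v.Completion y‖) h1
    simp only [map_pow, map_one, norm_pow, norm_one] at h2
    rw [extNorm, (pow_eq_one_iff_of_nonneg (norm_nonneg _) hk.ne').1 h2, Real.one_rpow]
  rw [Pi.zero_apply, logMap, hone, Real.log_one]
  rw [← Units.val_pow_eq_pow_val, ← map_pow, hzk, map_one, Units.val_one]

end Completion

/-! ### Archimedean completions and complex zeros -/

section Archimedean

variable {F : Type*} [Field F] {v : AbsoluteValue F ℝ} {σ : F →+* ℂ} {s : ℝ}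

/-- A complex embedding which induces a power of the given absolute value extends to the
completion. -/
lemma exists_completion_ringHom (hs : 0 < s) (hv : ∀ x, v x = ‖σ x‖ ^ s) :
    ∃ ψ : v.Completion →+* ℂ, Continuous ψ ∧ (∀ x, ψ (toCompletion v x) = σ x) ∧
      ∀ x, ‖x‖ = ‖ψ x‖ ^ s := by
  let σ' : WithAbs v →+* ℂ := σ.comp (WithAbs.equiv v).toRingHom
  have hσ' : ∀ x, ‖σ' x‖ = ‖x‖ ^ s⁻¹ := fun x => by
    have h : ‖x‖ = ‖σ' x‖ ^ s := hv x.ofAbs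
    rw [h, Real.rpow_rpow_inv (norm_nonneg _) hs.ne']
  have hcont : Continuous σ' := by
    refine continuous_of_continuousAt_zero σ' ?_
    rw [ContinuousAt, map_zero, tendsto_zero_iff_norm_tendsto_zero]
    simp only [hσ']
    have : Filter.Tendsto (fun x : WithAbs v => ‖x‖ ^ s⁻¹) (nhds 0) (nhds (‖(0 : WithAbs v)‖ ^ s⁻¹)) :=
      (continuous_norm.rpow_const fun _ => Or.inr (inv_pos.2 hs).le).tendsto 0
    rwa [norm_zero, Real.zero_rpow (inv_pos.2 hs).ne'] at this
  let ψ : v.Completion →+* ℂ := UniformSpace.Completion.extensionHom σ' hcont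
  have hψc : Continuous ψ := UniformSpace.Completion.continuous_extension
  have hψ : ∀ x : WithAbs v, ψ x = σ' x := fun x =>
    UniformSpace.Completion.extensionHom_coe σ' hcont x
  refine ⟨ψ, hψc, fun x => hψ _, fun x => ?_⟩
  induction x using UniformSpace.Completion.induction_on with
  | hp => exact isClosed_eq continuous_norm (hψc.norm.rpow_const fun _ => Or.inr hs.le)
  | ih x =>
    rw [hψ, hσ', UniformSpace.Completion.norm_coe, Real.rpow_inv_rpow (norm_nonneg _) hs.ne']

/-- Since `ψ` preserves norms up to a power, rationals converging to `r` form a Cauchy sequence in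
`k`, and their limit maps to `r`. -/
lemma exists_map_eq_ofReal {k : Type*} [NormedField k] [CompleteSpace k] (hs : 0 < s)
    {ψ : k →+* ℂ} (hψ : Continuous ψ) (hnorm : ∀ x, ‖x‖ = ‖ψ x‖ ^ s) (r : ℝ) :
    ∃ x, ψ x = r := by
  have : CharZero k := ψ.charZero
  obtain ⟨q, -, -, hq⟩ := Real.exists_seq_rat_strictMono_tendsto r
  have hcauchy : CauchySeq fun n => (q n : k) := by
    rw [Metric.cauchySeq_iff]
    intro ε hε
    obtain ⟨n, hn⟩ := Metric.cauchySeq_iff.1 hq.cauchySeq (ε ^ s⁻¹) (Real.rpow_pos_of_pos hε _)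
    refine ⟨n, fun i hi j hj => ?_⟩
    have h : ‖ψ ((q i : k) - q j)‖ = dist (q i : ℝ) (q j) := by
      rw [map_sub, map_ratCast, map_ratCast, Real.dist_eq, ← Real.norm_eq_abs,
        ← Complex.norm_real]
      simp
    rw [dist_eq_norm, hnorm, h]
    calc _ < (ε ^ s⁻¹) ^ s := Real.rpow_lt_rpow dist_nonneg (hn i hi j hj) hs
      _ = ε := Real.rpow_inv_rpow hε.le hs.ne'
  obtain ⟨x, hx⟩ := cauchySeq_tendsto_of_complete hcauchy
  refine ⟨x, tendsto_nhds_unique ((hψ.tendsto x).comp hx) ?_⟩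
  have h := (Complex.continuous_ofReal.tendsto r).comp hq
  refine h.congr fun n => ?_
  simp

lemma norm_eq_of_sq_sub_add_eq_zero {z r : ℂ} (h : r ^ 2 - (2 * z.re : ℝ) * r + (‖z‖ ^ 2 : ℝ) = 0) :
    ‖r‖ = ‖z‖ := by
  have h1 : (r - z) * (r - (starRingEnd ℂ) z) = 0 := by
    have h2 : z + (starRingEnd ℂ) z = (2 * z.re : ℝ) := Complex.add_conj z
    have h3 : z * (starRingEnd ℂ) z = (‖z‖ ^ 2 : ℝ) := by
      rw [Complex.mul_conj, Complex.normSq_eq_norm_sq]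
    rw [← h, ← h2, ← h3]
    ring
  rcases mul_eq_zero.1 h1 with h1 | h1
  · rw [sub_eq_zero.1 h1]
  · rw [sub_eq_zero.1 h1, Complex.norm_conj]

/-- The algebraic closure of an archimedean complete field is `ℂ`, and `extNorm` is a power of the
usual absolute value. -/
lemma exists_algebraicClosure_ringEquiv {k : Type*} [NormedField k] [CompleteSpace k] (hs : 0 < s)
    {ψ : k →+* ℂ} (hψ : Continuous ψ) (hnorm : ∀ x, ‖x‖ = ‖ψ x‖ ^ s) :
    ∃ e : AlgebraicClosure k ≃+* ℂ, (∀ x, e (algebraMap k _ x) = ψ x) ∧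
      ∀ a, extNorm k a = ‖e a‖ ^ s := by
  let _ : Algebra k ℂ := ψ.toAlgebra
  have hreal := exists_map_eq_ofReal hs hψ hnorm
  choose ρ hρ using hreal
  -- The real numbers come from `k`, so q z is a monic quadratic over `k` with roots z and its
  -- complex conjugate. Hence ℂ is algebraic over `k`, and all roots of the minimal polynomial of z
  -- have absolute value ‖z‖.
  let q : ℂ → k[X] := fun z => X ^ 2 - C (ρ (2 * z.re)) * X + C (ρ (‖z‖ ^ 2))
  have hq : ∀ z r : ℂ, aeval r (q z) = r ^ 2 - (2 * z.re : ℝ) * r + (‖z‖ ^ 2 : ℝ) := by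
    intro z r
    have h : ∀ x, algebraMap k ℂ x = ψ x := fun _ => rfl
    simp only [q, map_add, map_sub, map_mul, map_pow, aeval_X, aeval_C, h, hρ]
  have hqz : ∀ z, aeval z (q z) = 0 := by
    intro z
    have h2 : z + (starRingEnd ℂ) z = (2 * z.re : ℝ) := Complex.add_conj z
    have h3 : z * (starRingEnd ℂ) z = (‖z‖ ^ 2 : ℝ) := by
      rw [Complex.mul_conj, Complex.normSq_eq_norm_sq]
    rw [hq, ← h2, ← h3]
    ring
  have hqm : ∀ z, (q z).Monic := fun z => by
    simp only [q]
    monicity!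
  have halg : Algebra.IsAlgebraic k ℂ := ⟨fun z => ⟨q z, (hqm z).ne_zero, hqz z⟩⟩
  have : IsAlgClosure k ℂ := ⟨inferInstance, halg⟩
  let e : AlgebraicClosure k ≃ₐ[k] ℂ := IsAlgClosure.equiv k (AlgebraicClosure k) ℂ
  refine ⟨e.toRingEquiv, fun x => e.commutes x, fun a => ?_⟩
  set z : ℂ := e a with hz
  have hmin : minpoly k a = minpoly k z := (minpoly.algEquiv_eq e a).symm
  have hint : IsIntegral k z := Algebra.IsIntegral.isIntegral z
  have hmonic : ((minpoly k z).map (algebraMap k ℂ)).Monic := (minpoly.monic hint).map _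
  have hsplit : ((minpoly k z).map (algebraMap k ℂ)).Splits := IsAlgClosed.splits _
  have hroots : ∀ r ∈ ((minpoly k z).map (algebraMap k ℂ)).roots, ‖r‖ = ‖z‖ := by
    intro r hr
    have h1 : aeval r (minpoly k z) = 0 := by
      have := isRoot_of_mem_roots hr
      rwa [IsRoot.def, eval_map, ← aeval_def] at this
    obtain ⟨g, hg⟩ := minpoly.dvd k z (hqz z)
    refine norm_eq_of_sq_sub_add_eq_zero ?_
    rw [← hq, hg, map_mul, h1, zero_mul]
  have hcoeff : ‖ψ ((minpoly k z).coeff 0)‖ = ‖z‖ ^ (minpoly k z).natDegree := by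
    have h1 := hsplit.coeff_zero_eq_prod_roots_of_monic hmonic
    rw [coeff_map] at h1
    change ‖algebraMap k ℂ ((minpoly k z).coeff 0)‖ = _
    have h2 : (normHom : ℂ →*₀ ℝ) ((minpoly k z).map (algebraMap k ℂ)).roots.prod
        = ‖z‖ ^ (minpoly k z).natDegree := by
      rw [map_multiset_prod, Multiset.map_congr (f := normHom) (g := fun _ => ‖z‖) rfl hroots,
        Multiset.map_const', Multiset.prod_replicate, ← hsplit.natDegree_eq_card_roots, natDegree_map]
    rw [h1, norm_mul, norm_pow, norm_neg, norm_one, one_pow, one_mul]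
    exact h2
  have hdeg : ((minpoly k z).natDegree : ℝ) ≠ 0 := by
    exact_mod_cast (minpoly.natDegree_pos hint).ne'
  rw [extNorm_eq_coeff_zero, hmin, hnorm, hcoeff, ← Real.rpow_natCast, ← Real.rpow_mul (norm_nonneg _),
    ← Real.rpow_mul (norm_nonneg _)]
  congr 1
  field_simp

/-- A complex zero of a hypersurface gives a point of the corresponding archimedean amoeba. -/
lemma smul_log_mem_amoebaAt (hs : 0 < s) (hv : ∀ x, v x = ‖σ x‖ ^ s) {d : ℕ} (f : Laurent F d)
    (c : Fin d → ℂˣ)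
    (hc : ∑ n ∈ f.coeff.support, σ (f.coeff n) * (monomialAt c n : ℂˣ) = 0) :
    (s • fun i => Real.log ‖(c i : ℂ)‖) ∈ amoebaAt v (Ideal.span {f}) := by
  obtain ⟨ψ, hψ, hψσ, hψn⟩ := exists_completion_ringHom hs hv
  obtain ⟨e, he, hen⟩ := exists_algebraicClosure_ringEquiv hs hψ hψn
  have h := logMap_mem_amoebaAt v f
    (fun i => Units.map (e.symm : ℂ →+* AlgebraicClosure v.Completion).toMonoidHom (c i)) (by
      apply e.injective
      rw [map_sum, map_zero, ← hc]
      refine Finset.sum_congr rfl fun n _ => ?_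
      rw [← map_monomialAt, map_mul, he, hψσ]
      simp)
  convert h using 1
  funext i
  rw [logMap, hen, Real.log_rpow]
  · simp
  · simp

end Archimedean

/-! ### Spreading absence of complex zeros over a cone -/

section ComplexZeros

variable {d : ℕ}

/-- The Laurent polynomial `∑ aₙ zⁿ` has no complex zeros `z` with `Log z = w`. -/
def ZeroFreeAt (S : Finset (Fin d → ℤ)) (a : (Fin d → ℤ) → ℂ) (w : Fin d → ℝ) : Prop :=
  ∀ z : Fin d → ℂˣ, (∀ i, Real.log ‖(z i : ℂ)‖ = w i) → ∑ n ∈ S, a n * (monomialAt z n : ℂˣ) ≠ 0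

/-- The positive real point of the complex torus with given logarithms. -/
def expVec (w : Fin d → ℝ) : Fin d → ℂˣ := fun i => Units.mk0 (Complex.exp (w i)) (Complex.exp_ne_zero _)

lemma log_norm_expVec (w : Fin d → ℝ) (i : Fin d) : Real.log ‖(expVec w i : ℂ)‖ = w i := by
  simp [expVec, Complex.norm_exp]

lemma monomialAt_expVec (w : Fin d → ℝ) (n : Fin d → ℤ) :
    ((monomialAt (expVec w) n : ℂˣ) : ℂ) = Complex.exp (pairing n w : ℝ) := by
  simp only [monomialAt, Units.coe_prod, pairing, Units.val_zpow_eq_zpow_val, expVec,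
    Units.val_mk0, ← Complex.exp_int_mul, ← Complex.exp_sum]
  push_cast
  rfl

/-- Each root satisfies |y - x| ≥ (1 - |y|)|x|, and the factors |x| combine with the leading
coefficient to |Q(0)| = 1. The bound depends on `Q` only through `D`, so it is a closed condition in
a family. -/
lemma pow_le_norm_eval_of_roots {Q : ℂ[X]} {D : ℕ} (hD : Q.natDegree ≤ D) (h0 : Q.eval 0 = 1)
    (hroots : ∀ x, Q.eval x = 0 → 1 ≤ ‖x‖) {y : ℂ} (hy : ‖y‖ < 1) :
    (1 - ‖y‖) ^ D ≤ ‖Q.eval y‖ := by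
  have hy0 : 0 ≤ 1 - ‖y‖ := by linarith
  have key : ∀ s : Multiset ℂ, (∀ x ∈ s, 1 ≤ ‖x‖) →
      (1 - ‖y‖) ^ s.card * ‖((s.map fun x => X - C x).prod).eval 0‖
        ≤ ‖((s.map fun x => X - C x).prod).eval y‖ := by
    intro s
    induction s using Multiset.induction_on with
    | empty => simp
    | cons x s ih =>
      intro h
      have hx := h x (Multiset.mem_cons_self x s)
      have ih' := ih fun y hy => h y (Multiset.mem_cons_of_mem hy)
      have h1 : (1 - ‖y‖) * ‖x‖ ≤ ‖y - x‖ := by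
        have := norm_sub_norm_le x y
        rw [norm_sub_rev] at this
        nlinarith [norm_nonneg y]
      simp only [Multiset.map_cons, Multiset.prod_cons, Multiset.card_cons, eval_mul, eval_sub,
        eval_X, eval_C, zero_sub, norm_mul, norm_neg]
      calc _ = ((1 - ‖y‖) * ‖x‖) * ((1 - ‖y‖) ^ s.card *
            ‖((s.map fun x => X - C x).prod).eval 0‖) := by ring
        _ ≤ _ := mul_le_mul h1 ih' (by positivity) (norm_nonneg _)
  have hQ : Q ≠ 0 := by
    rintro rfl
    simp at h0
  have hsplit : Q.Splits := IsAlgClosed.splits Q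
  have hk := key Q.roots fun x hx => hroots x (isRoot_of_mem_roots hx)
  rw [← hsplit.natDegree_eq_card_roots] at hk
  have heq := hsplit.eq_prod_roots
  have h0' : ‖Q.leadingCoeff‖ * ‖((Q.roots.map fun x => X - C x).prod).eval 0‖ = 1 := by
    rw [← norm_mul, ← eval_C_mul, ← heq, h0, norm_one]
  calc (1 - ‖y‖) ^ D ≤ (1 - ‖y‖) ^ Q.natDegree :=
        pow_le_pow_of_le_one hy0 (by linarith [norm_nonneg y]) hD
    _ = ‖Q.leadingCoeff‖ * ((1 - ‖y‖) ^ Q.natDegree *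
          ‖((Q.roots.map fun x => X - C x).prod).eval 0‖) := by
        rw [mul_left_comm, h0', mul_one]
    _ ≤ ‖Q.leadingCoeff‖ * ‖((Q.roots.map fun x => X - C x).prod).eval y‖ := by gcongr
    _ = ‖Q.eval y‖ := by rw [← norm_mul, ← eval_C_mul, ← heq]

variable {S : Finset (Fin d → ℤ)} {a : (Fin d → ℤ) → ℂ} {v : Fin d → ℝ}

/-- If `1 + ∑ bₙ yᵉ⁽ⁿ⁾ exp (s cₙ)` with `cₙ < 0` has no zero on the unit circle for any `s ≥ 0`, then
it has no zero in the unit disc for any `s ≥ 0`. -/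
lemma no_zero_in_disc_of_no_zero_on_circle {ι : Type*} [DecidableEq ι] (S : Finset ι) {o : ι} (ho : o ∈ S)
    (b : ι → ℂ) (e : ι → ℕ) (c : ι → ℝ) (hb : b o = 1) (heo : e o = 0) (hco : c o = 0)
    (he : ∀ n ∈ S, n ≠ o → e n ≠ 0) (hc : ∀ n ∈ S, n ≠ o → c n < 0)
    (hcirc : ∀ s : ℝ, 0 ≤ s → ∀ y : ℂ, ‖y‖ = 1 →
      ∑ n ∈ S, b n * Complex.exp (s * c n : ℝ) * y ^ e n ≠ 0)
    {s : ℝ} (hs : 0 ≤ s) {y : ℂ} (hy : ‖y‖ ≤ 1) :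
    ∑ n ∈ S, b n * Complex.exp (s * c n : ℝ) * y ^ e n ≠ 0 := by
  intro hzero
  obtain ⟨G, hG⟩ : ∃ G : ℝ → ℂ → ℂ,
      G = fun s y => ∑ n ∈ S, b n * Complex.exp (s * c n : ℝ) * y ^ e n := ⟨_, rfl⟩
  replace hzero : G s y = 0 := by rw [hG]; exact hzero
  replace hcirc : ∀ s : ℝ, 0 ≤ s → ∀ y : ℂ, ‖y‖ = 1 → G s y ≠ 0 := by rw [hG]; exact hcirc
  have hGc : Continuous fun p : ℝ × ℂ => G p.1 p.2 := by
    simp only [hG]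
    fun_prop
  set D := S.sup e with hD
  -- `A` excludes zeros in the open disc and `B` records zeros in the closed disc. Both are closed,
  -- they cover s ≥ 0, and a common point would give a zero on the circle. Connectedness, with a
  -- point of `A` at large s, leaves no room for `B`.
  let A : Set ℝ := {s | ∀ y : ℂ, ‖y‖ < 1 → (1 - ‖y‖) ^ D ≤ ‖G s y‖}
  let B : Set ℝ := {s | ∃ y : ℂ, ‖y‖ ≤ 1 ∧ G s y = 0}
  have hA : IsClosed A := by
    have : A = ⋂ (y : ℂ) (_ : ‖y‖ < 1), {s | (1 - ‖y‖) ^ D ≤ ‖G s y‖} := by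
      ext s
      simp [A]
    rw [this]
    refine isClosed_iInter fun y => isClosed_iInter fun _ => isClosed_le continuous_const ?_
    exact (hGc.comp (Continuous.prodMk_left y)).norm
  have hB : IsClosed B := by
    have : B = Prod.fst '' {p : ℝ × Metric.closedBall (0 : ℂ) 1 | G p.1 p.2 = 0} := by
      ext s
      constructor
      · rintro ⟨y, hy, hs⟩
        exact ⟨(s, ⟨y, by simpa using hy⟩), hs, rfl⟩
      · rintro ⟨⟨s, y⟩, hs, rfl⟩
        exact ⟨y, mem_closedBall_zero_iff.1 y.2, hs⟩
    rw [this]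
    have hpair : Continuous fun p : ℝ × Metric.closedBall (0 : ℂ) 1 => (p.1, (p.2 : ℂ)) :=
      continuous_fst.prodMk (continuous_subtype_val.comp continuous_snd)
    exact isClosedMap_fst_of_compactSpace _ (isClosed_eq (hGc.comp hpair) continuous_const)
  have hcover : ∀ s, s ∉ B → s ∈ A := by
    intro s hsB y hy
    have hQ : ∀ y, (sumMonomials S (fun n => b n * Complex.exp (s * c n : ℝ)) e).eval y = G s y :=
      fun y => by rw [eval_sumMonomials, hG]
    rw [← hQ]
    refine pow_le_norm_eval_of_roots ?_ ?_ (fun x hx => ?_) hy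
    · refine natDegree_sum_le_of_forall_le _ _ fun n hn => ?_
      exact (natDegree_C_mul_X_pow_le _ _).trans (Finset.le_sup hn)
    · rw [hQ, hG]
      simp only
      rw [Finset.sum_eq_single_of_mem o ho fun n hn hne => by rw [zero_pow (he n hn hne), mul_zero]]
      simp [hb, heo, hco]
    · rw [hQ] at hx
      by_contra! h
      exact hsB ⟨x, h.le, hx⟩
  -- The terms other than `o` decay uniformly on the closed disc, and the term `o` is 1.
  have hlarge : ∃ s, 0 ≤ s ∧ s ∉ B := by
    have htend : Filter.Tendsto (fun s : ℝ => ∑ n ∈ S.erase o, ‖b n‖ * Real.exp (s * c n))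
        Filter.atTop (nhds 0) := by
      rw [← Finset.sum_const_zero (s := S.erase o)]
      refine tendsto_finsetSum _ fun n hn => ?_
      rw [← mul_zero ‖b n‖]
      refine Filter.Tendsto.const_mul _ (Real.tendsto_exp_atBot.comp ?_)
      exact Filter.tendsto_id.atTop_mul_const_of_neg
        (hc n (Finset.mem_of_mem_erase hn) (Finset.ne_of_mem_erase hn))
    obtain ⟨s, hs1, hs0⟩ := ((htend.eventually_lt_const one_pos).and
      (Filter.eventually_ge_atTop 0)).exists
    refine ⟨s, hs0, ?_⟩
    rintro ⟨y, hy, hsy⟩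
    simp only [hG] at hsy
    rw [← Finset.add_sum_erase S _ ho] at hsy
    have h1 : b o * Complex.exp (s * c o : ℝ) * y ^ e o = 1 := by simp [hb, heo, hco]
    rw [h1] at hsy
    have h2 : ‖∑ n ∈ S.erase o, b n * Complex.exp (s * c n : ℝ) * y ^ e n‖ = 1 := by
      rw [← neg_eq_of_add_eq_zero_right hsy, norm_neg, norm_one]
    have h3 : ‖∑ n ∈ S.erase o, b n * Complex.exp (s * c n : ℝ) * y ^ e n‖
        ≤ ∑ n ∈ S.erase o, ‖b n‖ * Real.exp (s * c n) := by
      refine (norm_sum_le _ _).trans (Finset.sum_le_sum fun n _ => ?_)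
      rw [norm_mul, norm_mul, norm_pow, Complex.norm_exp, Complex.ofReal_re]
      exact mul_le_of_le_one_right (by positivity) (pow_le_one₀ (norm_nonneg _) hy)
    linarith
  obtain ⟨s₁, hs₁, hs₁B⟩ := hlarge
  obtain ⟨s₂, hs₂, hs₂A, y₂, hy₂, hy₂0⟩ := (isPreconnected_closed_iff.1 isPreconnected_Ici A B hA hB
    (fun s _ => by
      by_cases h : s ∈ B
      · exact Or.inr h
      · exact Or.inl (hcover s h))
    ⟨s₁, hs₁, hcover s₁ hs₁B⟩ ⟨s, hs, y, hy, hzero⟩ : (Set.Ici (0 : ℝ) ∩ (A ∩ B)).Nonempty)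
  rcases hy₂.lt_or_eq with h | h
  · have := hs₂A y₂ h
    rw [hy₂0, norm_zero] at this
    exact absurd this (not_le.2 (pow_pos (by linarith) _))
  · exact hcirc s₂ hs₂ y₂ h hy₂0

/-- Along c₀ exp(s v) y^(-w) with Log c₀ = u, the equation is a polynomial in y with constant term
1. The circle |y| = 1 lies over u + s v, where there are no zeros, so there are none in the disc; y
= exp(-r) lies over u + r w + s v. -/
lemma ZeroFreeAt.add_direction (h0 : 0 ∈ S) (ha : a 0 = 1)
    (hv : ∀ n ∈ S, n ≠ 0 → pairing n v < 0) {w : Fin d → ℤ}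
    (hw : ∀ n ∈ S, n ≠ 0 → n ⬝ᵥ w < 0) {u : Fin d → ℝ}
    (hu : ∀ s : ℝ, 0 ≤ s → ZeroFreeAt S a (u + s • v)) {r : ℝ} (hr : 0 ≤ r) :
    ∀ s : ℝ, 0 ≤ s → ZeroFreeAt S a (u + r • (fun i => (w i : ℝ)) + s • v) := by
  intro s₁ hs₁ z hz hzero
  obtain ⟨c₀, hc₀⟩ : ∃ c₀, c₀ = z * expVec (-(r • fun i => (w i : ℝ)) - s₁ • v) := ⟨_, rfl⟩
  set e : (Fin d → ℤ) → ℕ := fun n => (-(n ⬝ᵥ w)).toNat with he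
  have heS : ∀ n ∈ S, (e n : ℤ) = -(n ⬝ᵥ w) := fun n hn => by
    rw [he]
    refine Int.toNat_of_nonneg ?_
    by_cases h : n = 0
    · simp [h]
    · linarith [hw n hn h]
  have hG : ∀ (s : ℝ) (y : ℂ) (hy : y ≠ 0),
      ∑ n ∈ S, (a n * (monomialAt c₀ n : ℂˣ)) * Complex.exp (s * pairing n v : ℝ) * y ^ e n
        = ∑ n ∈ S, a n * (monomialAt
          (c₀ * expVec (s • v) * fun i => Units.mk0 y hy ^ (-w) i) n : ℂˣ) := by
    intro s y hy
    refine Finset.sum_congr rfl fun n hn => ?_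
    rw [monomialAt_mul, monomialAt_mul, monomialAt_zpow, Units.val_mul, Units.val_mul,
      monomialAt_expVec, pairing_smul, Units.val_zpow_eq_zpow_val, Units.val_mk0, dotProduct_neg,
      ← heS n hn, zpow_natCast]
    ring
  have hlog : ∀ (s : ℝ) (y : ℂ) (hy : y ≠ 0) (i : Fin d),
      Real.log ‖((c₀ * expVec (s • v) * fun i => Units.mk0 y hy ^ (-w) i) i : ℂ)‖
        = u i + s * v i - w i * Real.log ‖y‖ := by
    intro s y hy i
    have hne : ∀ x : ℂˣ, ‖(x : ℂ)‖ ≠ 0 := fun x => norm_ne_zero_iff.2 x.ne_zero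
    simp only [hc₀, Pi.mul_apply, Units.val_mul, norm_mul]
    rw [Real.log_mul (mul_ne_zero (mul_ne_zero (hne _) (hne _)) (hne _)) (hne _),
      Real.log_mul (mul_ne_zero (hne _) (hne _)) (hne _), Real.log_mul (hne _) (hne _),
      log_norm_expVec, log_norm_expVec, hz, Units.val_zpow_eq_zpow_val, Units.val_mk0, norm_zpow,
      Real.log_zpow]
    simp
    ring
  refine no_zero_in_disc_of_no_zero_on_circle S h0 (fun n => a n * (monomialAt c₀ n : ℂˣ)) e
    (fun n => pairing n v) (by simp [ha]) (by simp [he]) (by simp) (fun n hn hne => ?_) hv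
    (fun s hs y hy => ?_) hs₁ (y := Complex.exp (-r : ℝ)) ?_ ?_
  · have := heS n hn
    have := hw n hn hne
    omega
  · have hy0 : y ≠ 0 := by
      rintro rfl
      simp at hy
    rw [hG s y hy0]
    refine hu s hs _ fun i => ?_
    rw [hlog, hy]
    simp
  · rw [Complex.norm_exp, Complex.ofReal_re]
    exact Real.exp_le_one_iff.2 (by linarith)
  · rw [hG _ _ (Complex.exp_ne_zero _), ← hzero]
    congr 1
    funext n
    congr 3
    funext i
    rw [Pi.mul_apply, Pi.mul_apply, hc₀, Pi.mul_apply]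
    apply Units.ext
    simp only [Units.val_mul, expVec, Units.val_mk0, Units.val_zpow_eq_zpow_val,
      ← Complex.exp_int_mul]
    rw [mul_assoc, mul_assoc, ← Complex.exp_add, ← Complex.exp_add]
    have : ((-(r • fun i => (w i : ℝ)) - s₁ • v) i : ℝ) + (((s₁ • v) i : ℝ)
        + ((-w) i : ℤ) * ((-r : ℝ) : ℂ)) = 0 := by
      simp
      ring
    rw [this, Complex.exp_zero, mul_one]

lemma eventually_pairing_neg (S : Finset (Fin d → ℤ)) (hv : ∀ n ∈ S, n ≠ 0 → pairing n v < 0)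
    (B : ℝ) : ∀ᶠ t : ℝ in Filter.atTop, ∀ n ∈ S, n ≠ 0 → ∀ x : Fin d → ℝ,
      (∀ i, |x i - t * v i| ≤ B) → pairing n x < 0 := by
  rw [Filter.eventually_all_finset]
  intro n hn
  by_cases h0 : n = 0
  · simp [h0]
  have hlim : Filter.Tendsto (fun t : ℝ => t * pairing n v) Filter.atTop Filter.atBot :=
    Filter.tendsto_id.atTop_mul_const_of_neg (hv n hn h0)
  filter_upwards [hlim.eventually_lt_atBot (-((∑ i, |(n i : ℝ)|) * B))] with t ht _ x hx
  have hsplit : pairing n x = t * pairing n v + pairing n (x - t • v) := by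
    rw [← pairing_smul, ← pairing_add, add_sub_cancel]
  have := (abs_le.1 (abs_pairing_le n (x - t • v) hx)).2
  linarith

/-- An open cone which contains `v` contains an integral direction `m` in which the exponents have
distinct degrees, and such that `m - t v` is for some `t > 0` a nonnegative combination of integral
vectors of the cone. -/
lemma exists_integral_direction (S : Finset (Fin d → ℤ))
    (hv : ∀ n ∈ S, n ≠ 0 → pairing n v < 0) :
    ∃ m : Fin d → ℤ, Set.InjOn (fun n : Fin d → ℤ => n ⬝ᵥ m) S ∧
      (∀ n ∈ S, n ≠ 0 → n ⬝ᵥ m < 0) ∧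
      ∃ (t : ℝ) (w : Option (Fin d) → Fin d → ℤ) (r : Option (Fin d) → ℝ), 0 < t ∧
        (∀ j, 0 ≤ r j) ∧ (∀ j, ∀ n ∈ S, n ≠ 0 → n ⬝ᵥ w j < 0) ∧
        (fun i => (m i : ℝ)) = t • v + ∑ j, r j • fun i => (w j i : ℝ) := by
  classical
  obtain ⟨μ, hμ⟩ := exists_injOn_dotProduct S
  -- The vector m will be congruent to `μ` modulo `K`. As `K` exceeds every |(n - n') · μ|, m
  -- separates the exponents because `μ` does.
  set K : ℤ := 1 + ∑ x ∈ S ×ˢ S, |(x.1 - x.2) ⬝ᵥ μ| with hK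
  have hKpos : 0 < K := by positivity
  have hKx : ∀ n ∈ S, ∀ n' ∈ S, |(n - n') ⬝ᵥ μ| < K := fun n hn n' hn' => by
    have := Finset.single_le_sum (f := fun x : (Fin d → ℤ) × (Fin d → ℤ) => |(x.1 - x.2) ⬝ᵥ μ|)
      (fun x _ => abs_nonneg _) (Finset.mk_mem_product hn hn')
    simp only at this
    omega
  have hKR : (0 : ℝ) < K := by exact_mod_cast hKpos
  set Bμ : ℝ := ∑ i, |(μ i : ℝ)| with hBμ
  have hBμi : ∀ i, |(μ i : ℝ)| ≤ Bμ := fun i =>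
    Finset.single_le_sum (f := fun i => |(μ i : ℝ)|) (fun i _ => abs_nonneg _) (Finset.mem_univ i)
  have hBμ0 : 0 ≤ Bμ := Finset.sum_nonneg fun i _ => abs_nonneg _
  -- All integral points below lie within `B` of t v or 2t v; beyond `T` this places them in the
  -- cone. Since m is close to 2t v, the difference u = m - t v is still close to t v.
  set B : ℝ := K + Bμ + 1 + (d + 1) with hB
  obtain ⟨T, hT⟩ := Filter.eventually_atTop.1 (eventually_pairing_neg S hv B)
  set t : ℝ := max T 1 * K with ht
  have hT1 : (1 : ℝ) ≤ max T 1 := le_max_right _ _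
  have hK1 : (1 : ℝ) ≤ K := by exact_mod_cast hKpos
  have ht1 : max T 1 ≤ t := le_mul_of_one_le_right (by linarith) hK1
  have ht0 : 0 < t := by linarith
  set p : Fin d → ℤ := fun i => ⌊2 * max T 1 * v i⌋ with hp
  set m : Fin d → ℤ := K • p + μ with hm
  have hmv : ∀ i, |(m i : ℝ) - 2 * t * v i| ≤ K + Bμ := by
    intro i
    have h1 := Int.floor_le (2 * max T 1 * v i)
    have h2 := Int.lt_floor_add_one (2 * max T 1 * v i)
    have h3 : (m i : ℝ) - 2 * t * v i = K * ((p i : ℝ) - 2 * max T 1 * v i) + μ i := by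
      simp only [hm, ht, Pi.add_apply, Pi.smul_apply, smul_eq_mul]
      push_cast
      ring
    rw [h3]
    refine (abs_add_le _ _).trans (add_le_add ?_ (hBμi i))
    rw [abs_mul, abs_of_pos hKR]
    refine mul_le_of_le_one_right hKR.le (abs_le.2 ?_)
    simp only [hp]
    constructor <;> linarith
  set u : Fin d → ℝ := fun i => m i - t * v i with hu
  set q : Fin d → ℤ := fun i => ⌊u i⌋ with hq
  have hqv : ∀ i, |(q i : ℝ) - t * v i| ≤ K + Bμ + 1 := by
    intro i
    have h1 := Int.floor_le (u i)
    have h2 := Int.lt_floor_add_one (u i)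
    have h3 := abs_le.1 (hmv i)
    simp only [hq]
    simp only [hu] at h1 h2 ⊢
    rw [abs_le]
    constructor <;> linarith [h3.1, h3.2]
  have hneg : ∀ (x : Fin d → ℤ) (s : ℝ), t ≤ s → (∀ i, |(x i : ℝ) - s * v i| ≤ B) →
      ∀ n ∈ S, n ≠ 0 → n ⬝ᵥ x < 0 := by
    intro x s hs hx n hn hn0
    have := hT s (by linarith [le_max_left T 1]) n hn hn0 (fun i => (x i : ℝ)) hx
    rw [pairing_intCast] at this
    exact_mod_cast this
  -- The vector u is a convex combination of the lattice points q and q + (d+1)eᵢ, the latter with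
  -- weights fract(uᵢ)/(d+1). The denominator d+1 keeps the weight of q nonnegative.
  refine ⟨m, ?_, hneg m (2 * t) (by linarith) fun i => (hmv i).trans (by rw [hB]; linarith), t,
    fun j => j.elim q fun i => q + Pi.single i ((d : ℤ) + 1),
    fun j => j.elim (1 - ∑ i, Int.fract (u i) / (d + 1)) fun i => Int.fract (u i) / (d + 1),
    ht0, ?_, ?_, ?_⟩
  · intro n hn n' hn' h
    simp only [hm, dotProduct_add, dotProduct_smul, smul_eq_mul] at h
    have h1 : (n - n') ⬝ᵥ μ = K * ((n' - n) ⬝ᵥ p) := by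
      rw [sub_dotProduct, sub_dotProduct]
      linarith
    have h2 := Int.eq_zero_of_abs_lt_dvd (Dvd.intro _ h1.symm) (hKx n hn n' hn')
    rw [sub_dotProduct, sub_eq_zero] at h2
    exact hμ hn hn' h2
  · rintro (_ | i)
    · simp only [Option.elim_none, sub_nonneg]
      calc _ ≤ ∑ _i : Fin d, (1 : ℝ) / (d + 1) := Finset.sum_le_sum fun i _ => by
            gcongr
            exact (Int.fract_lt_one _).le
        _ ≤ 1 := by
            rw [Finset.sum_const, Finset.card_univ, Fintype.card_fin, nsmul_eq_mul, mul_one_div,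
              div_le_one (by positivity)]
            linarith
    · exact div_nonneg (Int.fract_nonneg _) (by positivity)
  · rintro (_ | j)
    · exact hneg q t le_rfl fun i => (hqv i).trans (by rw [hB]; linarith)
    · refine hneg _ t le_rfl fun i => ?_
      have h1 : |((Pi.single j ((d : ℤ) + 1) : Fin d → ℤ) i : ℝ)| ≤ d + 1 := by
        by_cases hij : i = j
        · subst hij
          rw [Pi.single_eq_same]
          push_cast
          rw [abs_of_nonneg (by positivity)]
        · rw [Pi.single_eq_of_ne hij]
          simp
          positivity
      simp only [Option.elim_some, Pi.add_apply]
      push_cast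
      rw [add_sub_right_comm]
      exact (abs_add_le _ _).trans (add_le_add (hqv i) h1)
  · funext i
    rw [Fintype.sum_option]
    simp only [Option.elim_none, Option.elim_some, Pi.add_apply, Pi.smul_apply, smul_eq_mul,
      Finset.sum_apply]
    have h1 : ∀ j, Int.fract (u j) / ((d : ℝ) + 1) *
        ((q i + (Pi.single j ((d : ℤ) + 1) : Fin d → ℤ) i : ℤ) : ℝ)
        = Int.fract (u j) / (d + 1) * q i + if i = j then Int.fract (u j) else 0 := by
      intro j
      by_cases hij : i = j
      · subst hij
        rw [Pi.single_eq_same, if_pos rfl]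
        push_cast
        field_simp
      · rw [Pi.single_eq_of_ne hij, if_neg hij]
        simp
    simp only [h1, Finset.sum_add_distrib, ← Finset.sum_mul]
    have h2 : (q i : ℝ) + Int.fract (u i) = u i := Int.floor_add_fract (u i)
    rw [Finset.sum_ite_eq, if_pos (Finset.mem_univ _)]
    simp only [hu] at h2 ⊢
    linarith

end ComplexZeros

/-! ### Constructing nonarchimedean absolute values -/

section AbsoluteValues

variable {F : Type*} [Field F] {w : AbsoluteValue F ℝ}

lemma isNonarchimedean_of_isEquiv {v : AbsoluteValue F ℝ} (h : v.IsEquiv w)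
    (hw : IsNonarchimedean w) : IsNonarchimedean v := by
  intro x y
  rcases le_max_iff.1 (hw x y) with h' | h'
  · exact le_max_of_le_left (h.le_iff_le.2 h')
  · exact le_max_of_le_right (h.le_iff_le.2 h')

lemma isNonarchimedean_of_natCast_le_one (h : ∀ n : ℕ, w n ≤ 1) : IsNonarchimedean w := by
  let _ : NormedField F := w.toNormedField
  have := IsUltrametricDist.isUltrametricDist_of_forall_norm_natCast_le_one (R := F) h
  exact IsUltrametricDist.isNonarchimedean_norm

lemma apply_sum_le (hw : IsNonarchimedean w) {ι : Type*} (s : Finset ι) (g : ι → F) {M : ℝ}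
    (hM : 0 ≤ M) (h : ∀ i ∈ s, w (g i) ≤ M) : w (∑ i ∈ s, g i) ≤ M := by
  classical
  induction s using Finset.induction_on with
  | empty => simpa using hM
  | insert i s hi ih =>
    rw [Finset.sum_insert hi]
    exact (hw _ _).trans (max_le (h i (Finset.mem_insert_self i s))
      (ih fun j hj => h j (Finset.mem_insert_of_mem hj)))

/-- If |b| > 1, the leading term would strictly dominate all the others and could not cancel. -/
lemma le_one_of_aeval_eq_zero (hw : IsNonarchimedean w) {R : Type*} [CommRing R] [Algebra R F]
    (hR : ∀ r : R, w (algebraMap R F r) ≤ 1) {p : R[X]} (hp : w (algebraMap R F p.leadingCoeff) = 1)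
    {b : F} (hb : aeval b p = 0) : w b ≤ 1 := by
  by_contra! h1
  have hb0 : 0 < w b := one_pos.trans h1
  rw [aeval_eq_sum_range, Finset.sum_range_succ] at hb
  have h2 : w (∑ i ∈ Finset.range p.natDegree, p.coeff i • b ^ i) ≤ w b ^ p.natDegree / w b := by
    refine apply_sum_le hw _ _ (by positivity) fun i hi => ?_
    rw [Algebra.smul_def, map_mul, map_pow, le_div_iff₀ hb0, mul_assoc, ← pow_succ]
    exact (mul_le_of_le_one_left (by positivity) (hR _)).trans
      (pow_le_pow_right₀ h1.le (Finset.mem_range.1 hi))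
  rw [eq_neg_of_add_eq_zero_left hb, map_neg_eq_map, Algebra.smul_def, map_mul, map_pow,
    coeff_natDegree, hp, one_mul] at h2
  exact absurd h2 (not_le.2 (div_lt_self (by positivity) h1))

/-- A nonarchimedean absolute value extends to every algebraic extension. -/
lemma exists_extension {B F : Type*} [Field B] [Field F] [Algebra B F] [Algebra.IsAlgebraic B F]
    {u : AbsoluteValue B ℝ} (hu : IsNonarchimedean u) (hu' : u.IsNontrivial) :
    ∃ w : AbsoluteValue F ℝ, IsNonarchimedean w ∧ ∀ x, w (algebraMap B F x) = u x := by
  obtain ⟨N, hN, hNu, -⟩ := exists_absoluteValue_algebraicClosure_completion hu hu'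
  let _ : Algebra B (AlgebraicClosure u.Completion) :=
    ((algebraMap u.Completion (AlgebraicClosure u.Completion)).comp (toCompletion u)).toAlgebra
  let φ : F →ₐ[B] AlgebraicClosure u.Completion := IsAlgClosed.lift
  refine ⟨N.comp φ.toRingHom.injective, fun x y => ?_, fun x => ?_⟩
  · have h := hN (φ x) (φ y)
    rw [← map_add] at h
    exact h
  · exact (congrArg N (φ.commutes x)).trans (hNu x)

/-- Over a prime of a Dedekind domain there lies an absolute value of every algebraic extension. -/
lemma exists_absoluteValue_over_prime {R F : Type*} [CommRing R] [IsDedekindDomain R] [Field F]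
    [Algebra R F] [FaithfulSMul R F] [Algebra.IsAlgebraic R F] (P : HeightOneSpectrum R) :
    ∃ w : AbsoluteValue F ℝ, IsNonarchimedean w ∧ w.IsNontrivial ∧
      (∀ r : R, w (algebraMap R F r) ≤ 1) ∧
      ∀ r : R, w (algebraMap R F r) < 1 ↔ r ∈ P.asIdeal := by
  let _ : Algebra (FractionRing R) F := FractionRing.liftAlgebra R F
  have : Algebra.IsAlgebraic (FractionRing R) F :=
    (IsFractionRing.comap_isAlgebraic_iff (A := R) (K := FractionRing R) (C := F)).1 inferInstance
  have h2 : (1 : NNReal) < 2 := one_lt_two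
  obtain ⟨r, hrP, hr0⟩ := Submodule.exists_mem_ne_zero_of_ne_bot P.ne_bot
  obtain ⟨w, hw, hwu⟩ := exists_extension (F := F) (P.isNonarchimedean_adicAbv (K := FractionRing R) h2)
    ⟨algebraMap R _ r, by simpa using hr0,
      ((P.adicAbv_coe_lt_one_iff (K := FractionRing R) h2 r).2 hrP).ne⟩
  have hwR : ∀ r : R, w (algebraMap R F r) = P.adicAbv h2 (algebraMap R (FractionRing R) r) :=
    fun r => by rw [← hwu, ← IsScalarTower.algebraMap_apply]
  refine ⟨w, hw, ⟨algebraMap R F r, by simpa using hr0, ?_⟩, fun r => ?_, fun r => ?_⟩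
  · rw [hwR]
    exact ((P.adicAbv_coe_lt_one_iff (K := FractionRing R) h2 r).2 hrP).ne
  · rw [hwR]
    exact P.adicAbv_coe_le_one (K := FractionRing R) h2 r
  · rw [hwR]
    exact P.adicAbv_coe_lt_one_iff (K := FractionRing R) h2 r

/-- Finitely many nonzero elements are units at some nonarchimedean absolute value. -/
lemma exists_absoluteValue_eq_one {R F : Type*} [CommRing R] [IsDedekindDomain R] [Field F]
    [Algebra R F] [FaithfulSMul R F] [Algebra.IsAlgebraic R F]
    (hR : ∀ D : R, D ≠ 0 → ∃ P : HeightOneSpectrum R, D ∉ P.asIdeal) (T : Finset F) :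
    ∃ w : AbsoluteValue F ℝ, IsNonarchimedean w ∧ w.IsNontrivial ∧
      (∀ r : R, w (algebraMap R F r) ≤ 1) ∧ ∀ b ∈ T, b ≠ 0 → w b = 1 := by
  choose p hp0 hp using fun b : F => Algebra.IsAlgebraic.isAlgebraic (R := R) b
  -- At a prime where the leading coefficients of equations for b and b⁻¹ are units, both |b| and
  -- |b⁻¹| are at most 1.
  obtain ⟨P, hP⟩ := hR (∏ b ∈ T, (p b).leadingCoeff * (p b⁻¹).leadingCoeff)
    (Finset.prod_ne_zero_iff.2 fun b _ =>
      mul_ne_zero (leadingCoeff_ne_zero.2 (hp0 b)) (leadingCoeff_ne_zero.2 (hp0 b⁻¹)))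
  obtain ⟨w, hw, hw', hwR, hwP⟩ := exists_absoluteValue_over_prime (F := F) P
  refine ⟨w, hw, hw', hwR, fun b hb hb0 => ?_⟩
  have hlead : (p b).leadingCoeff * (p b⁻¹).leadingCoeff ∉ P.asIdeal := fun h =>
    hP (Ideal.mem_of_dvd _ (Finset.dvd_prod_of_mem _ hb) h)
  have hone : ∀ r : R, r ∉ P.asIdeal → w (algebraMap R F r) = 1 := fun r hr =>
    le_antisymm (hwR r) (not_lt.1 fun h => hr ((hwP r).1 h))
  have h1 := le_one_of_aeval_eq_zero hw hwR
    (hone _ fun h => hlead (Ideal.mul_mem_right _ _ h)) (hp b)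
  have h2 := le_one_of_aeval_eq_zero hw hwR
    (hone _ fun h => hlead (Ideal.mul_mem_left _ _ h)) (hp b⁻¹)
  rw [map_inv₀, inv_le_one₀ (w.pos hb0)] at h2
  exact le_antisymm h1 h2

lemma exists_prime_not_mem_int (D : ℤ) (hD : D ≠ 0) :
    ∃ P : HeightOneSpectrum ℤ, D ∉ P.asIdeal := by
  obtain ⟨p, hp, hpp⟩ := Nat.exists_infinite_primes (D.natAbs + 1)
  have hprime : Prime (p : ℤ) := Nat.prime_iff_prime_int.1 hpp
  refine ⟨⟨Ideal.span {(p : ℤ)}, (Ideal.span_singleton_prime hprime.ne_zero).2 hprime,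
    by simpa using hprime.ne_zero⟩, fun h => ?_⟩
  have h1 := Int.natAbs_dvd_natAbs.2 (Ideal.mem_span_singleton.1 h)
  have h2 := Nat.le_of_dvd (Int.natAbs_pos.2 hD) h1
  simp only [Int.natAbs_natCast] at h2
  omega

/-- Euclid's argument, valid also for finite `K`: an irreducible factor of X D + 1 cannot divide
`D`, and the factor X prevents X D + 1 from being constant. -/
lemma exists_prime_not_mem_polynomial {K : Type*} [Field K] (D : K[X]) (hD : D ≠ 0) :
    ∃ P : HeightOneSpectrum K[X], D ∉ P.asIdeal := by
  have hdeg : (X * D + 1).natDegree = D.natDegree + 1 := by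
    rw [natDegree_add_eq_left_of_natDegree_lt, natDegree_X_mul hD]
    rw [natDegree_X_mul hD, natDegree_one]
    omega
  have hne : X * D + 1 ≠ 0 := fun h => by
    rw [h, natDegree_zero] at hdeg
    omega
  have hunit : ¬ IsUnit (X * D + 1) := fun h => by
    rw [natDegree_eq_zero_of_isUnit h] at hdeg
    omega
  obtain ⟨p, hp, hpD⟩ := WfDvdMonoid.exists_irreducible_factor hunit hne
  refine ⟨⟨Ideal.span {p}, (Ideal.span_singleton_prime hp.ne_zero).2 hp.prime,
    by simpa using hp.ne_zero⟩, fun h => hp.not_isUnit ?_⟩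
  have h1 := Ideal.mem_span_singleton.1 h
  exact isUnit_of_dvd_one ((dvd_add_right (h1.mul_left X)).1 hpD)

end AbsoluteValues

/-! ### Places of function fields -/

section FunctionField

variable {F : Type*} [Field F] (K : Subfield F)

lemma apply_eq_one_of_polynomial {w : AbsoluteValue F ℝ} {x : F}
    (h : ∀ r : K[X], w (aeval x r) ≤ 1) (a : F) (ha : a ∈ K) (ha0 : a ≠ 0) : w a = 1 := by
  have h1 : ∀ a ∈ K, w a ≤ 1 := fun a ha => by
    have := h (C (⟨a, ha⟩ : K))
    rwa [aeval_C] at this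
  have h2 := h1 a⁻¹ (inv_mem ha)
  rw [map_inv₀, inv_le_one₀ (w.pos ha0)] at h2
  exact le_antisymm (h1 a ha) h2

variable {K}

/-- The polynomial ring already has transcendence degree one, so by additivity nothing is left for
`F` over it. -/
lemma isAlgebraic_polynomial (hK : Algebra.trdeg K F = 1) {x : F} (hx : Transcendental K x) :
    letI : Algebra K[X] F := (aeval x).toAlgebra
    FaithfulSMul K[X] F ∧ Algebra.IsAlgebraic K[X] F := by
  let _ : Algebra K[X] F := (aeval x).toAlgebra
  have : IsScalarTower K K[X] F := IsScalarTower.of_algebraMap_eq fun a => (aeval_C x a).symm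
  have hf : FaithfulSMul K[X] F := (faithfulSMul_iff_algebraMap_injective K[X] F).2
    (transcendental_iff_injective.1 hx)
  refine ⟨hf, ?_⟩
  rw [← trdeg_eq_zero_iff]
  have h := trdeg_add_eq K K[X] (A := F)
  rw [hK, Polynomial.trdeg_of_isDomain] at h
  exact (Cardinal.add_right_inj_of_lt_aleph0 Cardinal.one_lt_aleph0).1 ((add_comm _ _).trans (h.trans (zero_add 1).symm))

lemma exists_absoluteValue_lt_one (hK : Algebra.trdeg K F = 1) {x : F} (hx : Transcendental K x) :
    ∃ w : AbsoluteValue F ℝ, IsNonarchimedean w ∧ w.IsNontrivial ∧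
      (∀ a ∈ K, a ≠ 0 → w a = 1) ∧ w x < 1 := by
  let _ : Algebra K[X] F := (aeval x).toAlgebra
  obtain ⟨_, _⟩ := isAlgebraic_polynomial hK hx
  obtain ⟨w, hw, hw', hwR, hwP⟩ := exists_absoluteValue_over_prime (F := F)
    (⟨Ideal.span {X}, (Ideal.span_singleton_prime X_ne_zero).2 prime_X, by simp⟩ :
      HeightOneSpectrum K[X])
  refine ⟨w, hw, hw', apply_eq_one_of_polynomial K hwR, ?_⟩
  have h : aeval x (X : K[X]) = x := aeval_X x
  rw [← h]
  exact (hwP X).2 (Ideal.mem_span_singleton_self X)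

lemma exists_absoluteValue_eq_one_of_trdeg (hK : Algebra.trdeg K F = 1) (T : Finset F) :
    ∃ w : AbsoluteValue F ℝ, IsNonarchimedean w ∧ w.IsNontrivial ∧
      (∀ a ∈ K, a ≠ 0 → w a = 1) ∧ ∀ b ∈ T, b ≠ 0 → w b = 1 := by
  have htr : Algebra.Transcendental K F := trdeg_ne_zero_iff.1 (by simp [hK])
  obtain ⟨x, hx⟩ := htr.transcendental
  let _ : Algebra K[X] F := (aeval x).toAlgebra
  obtain ⟨_, _⟩ := isAlgebraic_polynomial hK hx
  obtain ⟨w, hw, hw', hwR, hwT⟩ :=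
    exists_absoluteValue_eq_one (F := F) (exists_prime_not_mem_polynomial (K := K)) T
  exact ⟨w, hw, hw', apply_eq_one_of_polynomial K hwR, hwT⟩

/-- Otherwise x⁻¹ would be algebraic over constants of norm 1, forcing |x⁻¹| ≤ 1. -/
lemma transcendental_of_lt_one {w : AbsoluteValue F ℝ} (hw : IsNonarchimedean w)
    (hwK : ∀ a ∈ K, a ≠ 0 → w a = 1) {x : F} (hx0 : x ≠ 0) (hx : w x < 1) : Transcendental K x := by
  intro h
  obtain ⟨p, hp0, hp⟩ := h.inv
  have hK : ∀ a : K, a ≠ 0 → w (algebraMap K F a) = 1 := fun a ha =>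
    hwK a a.2 (by simpa using ha)
  have h1 := le_one_of_aeval_eq_zero hw (fun a : K => by
    by_cases ha : a = 0
    · simp [ha]
    · exact (hK a ha).le) (hK _ (leadingCoeff_ne_zero.2 hp0)) hp
  rw [map_inv₀, inv_le_one₀ (w.pos hx0)] at h1
  linarith

lemma isNonarchimedean_of_trivial_on_subfield {w : AbsoluteValue F ℝ}
    (hwK : ∀ a ∈ K, a ≠ 0 → w a = 1) : IsNonarchimedean w := by
  refine isNonarchimedean_of_natCast_le_one fun n => ?_
  by_cases h : (n : F) = 0
  · simp [h]
  · exact (hwK n (natCast_mem K n) h).le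

end FunctionField

/-! ### Representatives of places, normalized equations and dominant coefficients -/

lemma exists_place_isEquiv {F : Type*} [Field F] {C : Set F} {rep : Place F C → Norms F C}
    (hrep : ∀ p, (rep p).place = p) {w : AbsoluteValue F ℝ} (hw : w.IsNontrivial)
    (hC : ∀ a ∈ C, a ≠ 0 → w a = 1) : ∃ p, (rep p).1.IsEquiv w := by
  let w' : Norms F C := ⟨w, hw, hC⟩
  exact ⟨w'.place, Quotient.exact (hrep w'.place)⟩

section Normalization

variable {d : ℕ} {k : Type*} [Field k]

lemma exists_ne_mem_support {f : Laurent k d} (hu : ¬ IsUnit f) {n₀ : Fin d → ℤ}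
    (hn₀ : n₀ ∈ f.coeff.support) : ∃ n ∈ f.coeff.support, n ≠ n₀ := by
  by_contra! h
  refine hu ?_
  have : f = AddMonoidAlgebra.single n₀ (f.coeff n₀) := by
    ext n
    by_cases hn : n = n₀
    · subst hn
      simp
    · have h0 : f.coeff n = 0 := by
        by_contra h0
        exact hn (h n (Finsupp.mem_support_iff.2 h0))
      rw [h0, AddMonoidAlgebra.coeff_single, Finsupp.single_eq_of_ne hn]
  rw [this]
  exact isUnit_single _ (Finsupp.mem_support_iff.1 hn₀)

/-- A hypersurface has an equation with constant term `1` whose other exponents are the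
differences to a given exponent. -/
lemma exists_normalized_equation {f : Laurent k d} {n₀ : Fin d → ℤ} (hn₀ : n₀ ∈ f.coeff.support) :
    ∃ g : Laurent k d, Ideal.span {g} = Ideal.span {f} ∧ g.coeff 0 = 1 ∧
      ∀ n, n ∈ g.coeff.support ↔ n + n₀ ∈ f.coeff.support := by
  have ha : f.coeff n₀ ≠ 0 := Finsupp.mem_support_iff.1 hn₀
  have hcoeff : ∀ n, (AddMonoidAlgebra.single (-n₀) (f.coeff n₀)⁻¹ * f).coeff n
      = (f.coeff n₀)⁻¹ * f.coeff (n + n₀) := by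
    intro n
    have h : n = -n₀ + (n + n₀) := by abel
    conv_lhs => rw [h]
    rw [AddMonoidAlgebra.coeff_single_mul_add]
  refine ⟨AddMonoidAlgebra.single (-n₀) (f.coeff n₀)⁻¹ * f,
    span_singleton_mul_unit f _ (isUnit_single _ (inv_ne_zero ha)), ?_, fun n => ?_⟩
  · rw [hcoeff, zero_add, inv_mul_cancel₀ ha]
  · rw [Finsupp.mem_support_iff, Finsupp.mem_support_iff, hcoeff]
    simp [ha]

end Normalization

/-- If a ray in the outer normal cone of the vertex `0` misses a nonarchimedean amoeba, then the
coefficient of this vertex is dominant. -/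
lemma apply_coeff_le_one_of_ray_disjoint {F : Type*} [Field F] {w : AbsoluteValue F ℝ}
    (hw : IsNonarchimedean w) (hw' : w.IsNontrivial) {d : ℕ} {f : Laurent F d} {v : Fin d → ℝ}
    (h0 : f.coeff 0 = 1) (hv : ∀ n ∈ f.coeff.support, n ≠ 0 → pairing n v < 0)
    (hray : ∀ t : ℝ, 0 < t → t • v ∉ amoebaAt w (Ideal.span {f})) :
    ∀ n ∈ f.coeff.support, w (f.coeff n) ≤ 1 := by
  classical
  intro n₁ hn₁
  by_contra! h1
  have hn₁0 : n₁ ≠ 0 := by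
    rintro rfl
    simp [h0] at h1
  have h0S : (0 : Fin d → ℤ) ∈ f.coeff.support := by simp [h0]
  -- The term n ties with the constant term at t = τ n. The last tie is a corner of the tropical
  -- polynomial, and it lies on the open ray if some coefficient has norm greater than 1.
  let τ : (Fin d → ℤ) → ℝ := fun n => Real.log (w (f.coeff n)) / -pairing n v
  obtain ⟨n₂, hn₂, hmax⟩ := Finset.exists_max_image (f.coeff.support.erase 0) τ
    ⟨n₁, Finset.mem_erase.2 ⟨hn₁0, hn₁⟩⟩
  obtain ⟨hn₂0, hn₂S⟩ := Finset.mem_erase.1 hn₂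
  have hpos : 0 < τ n₂ :=
    (div_pos (Real.log_pos h1) (neg_pos.2 (hv n₁ hn₁ hn₁0))).trans_le
      (hmax n₁ (Finset.mem_erase.2 ⟨hn₁0, hn₁⟩))
  refine hray (τ n₂) hpos (mem_amoebaAt_of_max_attained_twice hw hw' f _ 0 (fun n hn => ?_) h0S hn₂S
    hn₂0.symm (by simp [h0]) ?_)
  · by_cases hn0 : n = 0
    · simp [hn0, h0]
    · have := hmax n (Finset.mem_erase.2 ⟨hn0, hn⟩)
      have hneg := neg_pos.2 (hv n hn hn0)
      rw [div_le_iff₀ hneg] at this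
      rw [pairing_smul]
      linarith
  · have hneg := (neg_pos.2 (hv n₂ hn₂S hn₂0)).ne'
    rw [pairing_smul]
    have : τ n₂ * -pairing n₂ v = Real.log (w (f.coeff n₂)) := div_mul_cancel₀ _ hneg
    linarith

/-- A number field or function field has a nonarchimedean norm at which finitely many given
nonzero elements are units. -/
lemma exists_norm_eq_one {F : Type*} [Field F] {C : Set F} (hF : IsNumberOrFunctionField F C)
    (T : Finset F) :
    ∃ w : AbsoluteValue F ℝ, IsNonarchimedean w ∧ w.IsNontrivial ∧
      (∀ a ∈ C, a ≠ 0 → w a = 1) ∧ ∀ b ∈ T, b ≠ 0 → w b = 1 := by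
  rcases hF with ⟨hnf, rfl⟩ | ⟨K, rfl, -, hK⟩
  · have : Algebra.IsAlgebraic ℤ F :=
      (IsFractionRing.comap_isAlgebraic_iff (A := ℤ) (K := ℚ) (C := F)).2 inferInstance
    obtain ⟨w, hw, hw', -, hwT⟩ := exists_absoluteValue_eq_one (F := F) exists_prime_not_mem_int T
    exact ⟨w, hw, hw', fun a ha => ha.elim, hwT⟩
  · exact exists_absoluteValue_eq_one_of_trdeg hK T

/-! ### Integrality and torsion points over number fields -/

section NumberField

/-- Kronecker's theorem in an algebraic extension of `ℚ`. -/
lemma exists_pow_eq_one_of_norm_le_one {E : Type*} [Field E] [CharZero E] [Algebra.IsAlgebraic ℚ E]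
    {x : E} (hx0 : x ≠ 0) (hx : IsIntegral ℤ x) (h : ∀ Φ : E →+* ℂ, ‖Φ x‖ ≤ 1) :
    ∃ k : ℕ, 0 < k ∧ x ^ k = 1 := by
  have hxQ : IsIntegral ℚ x := Algebra.IsIntegral.isIntegral x
  have : FiniteDimensional ℚ ℚ⟮x⟯ := IntermediateField.adjoin.finiteDimensional hxQ
  have : NumberField ℚ⟮x⟯ := ⟨⟩
  have : Algebra.IsAlgebraic ℚ⟮x⟯ E := Algebra.IsAlgebraic.tower_top (K := ℚ) ℚ⟮x⟯
  let g : ℚ⟮x⟯ := IntermediateField.AdjoinSimple.gen ℚ x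
  have hg : (g : E) = x := IntermediateField.AdjoinSimple.coe_gen ℚ x
  have hgint : IsIntegral ℤ g :=
    (isIntegral_algebraMap_iff (B := E) (algebraMap ℚ⟮x⟯ E).injective).1 (by
      change IsIntegral ℤ (g : E)
      rwa [hg])
  obtain ⟨k, hk, hgk⟩ := NumberField.Embeddings.pow_eq_one_of_norm_le_one ℚ⟮x⟯ ℂ (x := g)
    (fun h0 => hx0 (by rw [← hg, h0]; rfl)) hgint fun φ => by
      let _ : Algebra ℚ⟮x⟯ ℂ := φ.toAlgebra
      -- Every complex embedding of ℚ(x) extends to `E`, so the bound on embeddings of `E` covers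
      -- all conjugates of x.
      let Φ : E →ₐ[ℚ⟮x⟯] ℂ := IsAlgClosed.lift
      have h1 : Φ (g : E) = φ g := Φ.commutes g
      rw [← h1, hg]
      exact h Φ.toRingHom
  refine ⟨k, hk, ?_⟩
  rw [← hg]
  exact_mod_cast congrArg (fun y : ℚ⟮x⟯ => (y : E)) hgk

/-- Dividing by a high power of `y` reverses the polynomial, and the constant term 1 becomes the
leading coefficient. -/
lemma isIntegral_of_sum_eq_zero {E ι : Type*} [Field E] [DecidableEq ι] (S : Finset ι) {o : ι}
    (ho : o ∈ S) (a : ι → E) (e : ι → ℕ) (hao : a o = 1) (heo : e o = 0)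
    (he : ∀ n ∈ S, n ≠ o → e n ≠ 0) (ha : ∀ n ∈ S, IsIntegral ℤ (a n)) {y : E} (hy0 : y ≠ 0)
    (hy : ∑ n ∈ S, a n * y ^ e n = 0) : IsIntegral ℤ y⁻¹ := by
  let A := integralClosure ℤ E
  let α : ι → A := fun n => if h : n ∈ S then ⟨a n, ha n h⟩ else 0
  have hα : ∀ n ∈ S, algebraMap A E (α n) = a n := fun n hn => by
    simp only [α, dif_pos hn]
    rfl
  set N := S.sup e with hN
  set q : A[X] := ∑ n ∈ S.erase o, C (α n) * X ^ (N - e n) with hq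
  have heN : ∀ n ∈ S, e n ≤ N := fun n hn => Finset.le_sup hn
  have hdeg : q.degree < N := by
    rw [← mem_degreeLT]
    refine Submodule.sum_mem _ fun n hn => mem_degreeLT.2 ?_
    obtain ⟨hne, hnS⟩ := Finset.mem_erase.1 hn
    refine (degree_C_mul_X_pow_le _ _).trans_lt ?_
    have h1 := he n hnS hne
    have h2 := heN n hnS
    exact_mod_cast (by omega : N - e n < N)
  have hint : IsIntegral A y⁻¹ := by
    refine ⟨X ^ N + q, monic_X_pow_add hdeg, ?_⟩
    have h1 : eval₂ (algebraMap A E) y⁻¹ q = ∑ n ∈ S.erase o, a n * y⁻¹ ^ (N - e n) := by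
      rw [hq, eval₂_finsetSum]
      refine Finset.sum_congr rfl fun n hn => ?_
      rw [eval₂_mul, eval₂_C, eval₂_X_pow, hα n (Finset.mem_of_mem_erase hn)]
    have h2 : ∀ n ∈ S, y⁻¹ ^ (N - e n) = y⁻¹ ^ N * y ^ e n := fun n hn => by
      rw [pow_sub₀ _ (inv_ne_zero hy0) (heN n hn), inv_pow y (e n), inv_inv]
    have h3 : ∑ n ∈ S, a n * y⁻¹ ^ (N - e n) = 0 := by
      rw [← mul_zero (y⁻¹ ^ N), ← hy, Finset.mul_sum]
      exact Finset.sum_congr rfl fun n hn => by rw [h2 n hn]; ring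
    rw [eval₂_add, eval₂_X_pow, h1, ← h3, ← Finset.add_sum_erase S _ ho, hao, heo, one_mul,
      Nat.sub_zero]
  exact isIntegral_trans (R := ℤ) (A := A) _ hint

variable {F : Type*} [Field F] [NumberField F]

lemma isIntegral_of_forall_nonarchimedean {a : F}
    (h : ∀ w : AbsoluteValue F ℝ, IsNonarchimedean w → w.IsNontrivial → w a ≤ 1) :
    IsIntegral ℤ a := by
  have h2 : (1 : NNReal) < 2 := one_lt_two
  obtain ⟨b, rfl⟩ := HeightOneSpectrum.mem_integers_of_valuation_le_one (R := NumberField.RingOfIntegers F)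
    F a fun P => by
      obtain ⟨r, hrP, hr0⟩ := Submodule.exists_mem_ne_zero_of_ne_bot P.ne_bot
      have h1 := h (P.adicAbv h2) (P.isNonarchimedean_adicAbv h2)
        ⟨algebraMap _ F r, by simpa using hr0, ((P.adicAbv_coe_lt_one_iff (K := F) h2 r).2 hrP).ne⟩
      have h3 : WithZeroMulInt.toNNReal (ne_zero_of_lt h2) (P.valuation F a) ≤ 1 := h1
      exact (WithZeroMulInt.toNNReal_le_one_iff h2).1 h3
  exact b.isIntegral_coe

variable {d : ℕ} {f : Laurent F d} {v : Fin d → ℝ}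

/-- The representative of the place of `σ` is a power ‖σ ·‖ ^ s, which rescales logarithms by s > 0
and so preserves the ray. -/
lemma zeroFreeAt_of_ray_disjoint {C : Set F} (hC : C = ∅) {rep : Place F C → Norms F C}
    (hrep : ∀ p, (rep p).place = p) {I : Ideal (Laurent F d)} (hI : I = Ideal.span {f})
    (hray : ∀ p, ∀ t : ℝ, 0 < t → t • v ∉ amoebaAt (rep p).1 I)
    (σ : F →+* ℂ) {t : ℝ} (ht : 0 < t) :
    ZeroFreeAt f.coeff.support (fun n => σ (f.coeff n)) (t • v) := by
  intro z hz hzero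
  obtain ⟨p, hp⟩ := exists_place_isEquiv hrep (w := NumberField.place σ)
    ⟨2, two_ne_zero, by rw [NumberField.place_apply, map_ofNat, Complex.norm_ofNat]; norm_num⟩
    (by simp [hC])
  obtain ⟨s, hs, hps⟩ := AbsoluteValue.isEquiv_iff_exists_rpow_eq.1 hp.symm
  have h := smul_log_mem_amoebaAt (v := (rep p).1) (σ := σ) hs (fun x => (congrFun hps x).symm) f z
    hzero
  rw [funext hz, smul_smul, ← hI] at h
  exact hray p (s * t) (mul_pos hs ht) h

lemma exists_torsion_point (h0 : f.coeff 0 = 1) (hv : ∀ n ∈ f.coeff.support, n ≠ 0 → pairing n v < 0)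
    (hne : ∃ n ∈ f.coeff.support, n ≠ 0) (hint : ∀ n ∈ f.coeff.support, IsIntegral ℤ (f.coeff n))
    (hfree : ∀ (σ : F →+* ℂ) (t : ℝ), 0 < t →
      ZeroFreeAt f.coeff.support (fun n => σ (f.coeff n)) (t • v)) :
    ∃ z : Fin d → (AlgebraicClosure F)ˣ,
      ∑ n ∈ f.coeff.support, algebraMap F (AlgebraicClosure F) (f.coeff n) *
        (monomialAt z n : (AlgebraicClosure F)ˣ) = 0 ∧ ∀ i, ∃ k : ℕ, 0 < k ∧ z i ^ k = 1 := by
  classical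
  set S := f.coeff.support with hS
  have h0S : (0 : Fin d → ℤ) ∈ S := by simp [hS, h0]
  obtain ⟨m, hm, hmneg, t, w, r, ht, hr, hw, hmeq⟩ := exists_integral_direction S hv
  have hfree' : ∀ (σ : F →+* ℂ) (s : ℝ), 0 < s →
      ZeroFreeAt S (fun n => σ (f.coeff n)) (s • fun i => (m i : ℝ)) := by
    intro σ s hs
    -- The summands of m = t v + ∑ rⱼ wⱼ are added one at a time. The extra s' v is what lets
    -- `ZeroFreeAt.add_direction` be iterated.
    have hstep : ∀ J : Finset (Option (Fin d)), ∀ s' : ℝ, 0 ≤ s' →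
        ZeroFreeAt S (fun n => σ (f.coeff n))
          ((s * t) • v + ∑ j ∈ J, (s * r j) • (fun i => (w j i : ℝ)) + s' • v) := by
      intro J
      induction J using Finset.induction_on with
      | empty =>
        intro s' hs'
        rw [Finset.sum_empty, add_zero, ← add_smul]
        exact hfree σ _ (by positivity)
      | insert j J hj ih =>
        rw [Finset.sum_insert hj, add_comm (_ • fun i => (w j i : ℝ)), ← add_assoc]
        exact ZeroFreeAt.add_direction h0S (by simp [h0]) hv (hw j) ih (mul_nonneg hs.le (hr j))
    have := hstep Finset.univ 0 le_rfl
    rw [zero_smul, add_zero] at this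
    rw [hmeq, smul_add, smul_smul, Finset.smul_sum]
    simpa only [smul_smul] using this
  let E := AlgebraicClosure F
  set e : (Fin d → ℤ) → ℕ := fun n => (-(n ⬝ᵥ m)).toNat with he
  have heS : ∀ n ∈ S, (e n : ℤ) = -(n ⬝ᵥ m) := fun n hn => by
    refine Int.toNat_of_nonneg ?_
    by_cases h : n = 0
    · simp [h]
    · linarith [hmneg n hn h]
  have he0 : e 0 = 0 := by simp [he]
  have hene : ∀ n ∈ S, n ≠ 0 → e n ≠ 0 := fun n hn h => by
    have := heS n hn
    have := hmneg n hn h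
    omega
  have hinj : Set.InjOn e S := fun n hn n' hn' h => hm hn hn' (by
    have h1 := heS n hn
    have h2 := heS n' hn'
    rw [h] at h1
    simp only
    omega)
  set a : (Fin d → ℤ) → E := fun n => algebraMap F E (f.coeff n) with ha
  -- Here y = x⁻¹ on the subgroup x ↦ xᵐ; the polynomial is nonconstant because distinct exponents
  -- have distinct degrees.
  obtain ⟨y, hy⟩ : ∃ y, (sumMonomials S a e).IsRoot y := by
    refine IsAlgClosed.exists_root _ fun hdeg => ?_
    obtain ⟨n, hn, hn0⟩ := hne
    have h1 : (sumMonomials S a e).coeff (e n) ≠ 0 := by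
      rw [coeff_sumMonomials S a e hinj hn, ha]
      exact (_root_.map_ne_zero _).2 (Finsupp.mem_support_iff.1 hn)
    exact h1 (coeff_eq_zero_of_degree_lt (by
      rw [hdeg]
      exact_mod_cast Nat.pos_of_ne_zero (hene n hn hn0)))
  rw [IsRoot.def, eval_sumMonomials] at hy
  have hy0 : y ≠ 0 := by
    rintro rfl
    rw [Finset.sum_eq_single_of_mem 0 h0S fun n hn hne => by
      rw [zero_pow (hene n hn hne), mul_zero]] at hy
    simp [ha, h0, he0] at hy
  have hxint : IsIntegral ℤ y⁻¹ := isIntegral_of_sum_eq_zero S h0S a e (by simp [ha, h0]) he0 hene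
    (fun n hn => (hint n hn).map (algebraMap F E).toIntAlgHom) hy0 hy
  let x : Eˣ := (Units.mk0 y hy0)⁻¹
  have hx : (x : E) = y⁻¹ := by simp [x]
  have hpow : ∀ n ∈ S, x ^ (n ⬝ᵥ m) = Units.mk0 y hy0 ^ e n := fun n hn => by
    rw [inv_zpow', ← heS n hn, zpow_natCast]
  have hzero : ∑ n ∈ S, a n * (monomialAt (fun i => x ^ m i) n : Eˣ) = 0 := by
    rw [← hy]
    refine Finset.sum_congr rfl fun n hn => ?_
    rw [monomialAt_zpow, hpow n hn, Units.val_pow_eq_pow_val, Units.val_mk0]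
  have : Algebra.IsAlgebraic ℚ E := Algebra.IsAlgebraic.trans ℚ F E
  -- A conjugate of absolute value greater than 1 would give a complex zero over log ‖Φ y⁻¹‖ · m, on
  -- the zero-free ray.
  obtain ⟨k, hk, hxk⟩ := exists_pow_eq_one_of_norm_le_one (inv_ne_zero hy0) hxint fun Φ => by
    by_contra! hnorm
    refine hfree' (Φ.comp (algebraMap F E)) (Real.log ‖Φ y⁻¹‖) (Real.log_pos hnorm)
      (fun i => Units.map Φ.toMonoidHom (x ^ m i)) (fun i => ?_) ?_
    · have h1 : ((Units.map Φ.toMonoidHom (x ^ m i) : ℂˣ) : ℂ) = Φ y⁻¹ ^ m i := by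
        rw [← hx, ← map_zpow₀, ← Units.val_zpow_eq_zpow_val]
        rfl
      rw [h1, norm_zpow, Real.log_zpow]
      simp [mul_comm]
    · have h1 := congrArg Φ hzero
      rw [map_sum, map_zero] at h1
      rw [← h1]
      refine Finset.sum_congr rfl fun n _ => ?_
      rw [map_mul, map_monomialAt]
      rfl
  refine ⟨fun i => x ^ m i, hzero, fun i => ⟨k, hk, ?_⟩⟩
  have hxk' : x ^ k = 1 := Units.ext (by rw [Units.val_pow_eq_pow_val, hx, hxk, Units.val_one])
  rw [← zpow_natCast, zpow_comm, zpow_natCast, hxk', one_zpow]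

end NumberField

end AdelicAmoeba

end

/-! ### Proof of the theorem -/

open AdelicAmoeba

theorem mainTheorem4 {F : Type*} [Field F] (C : Set F)
    (hF : AdelicAmoeba.IsNumberOrFunctionField F C)
    (rep : AdelicAmoeba.Place F C → AdelicAmoeba.Norms F C)
    (hrep : ∀ p, (rep p).place = p)
    {d : ℕ} (X : Ideal (AdelicAmoeba.Laurent F d)) (hX : AdelicAmoeba.IsHypersurface X)
    (h0 : ∃ p, (0 : Fin d → ℝ) ∉ AdelicAmoeba.amoebaAt (rep p).1 X)
    (v : Fin d → ℝ) (hv : v ≠ 0) :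
    ∃ t : ℝ, 0 < t ∧ t • v ∈ AdelicAmoeba.adelicAmoeba rep X := by
  classical
  by_contra! hmiss
  have hray : ∀ p, ∀ t : ℝ, 0 < t → t • v ∉ amoebaAt (rep p).1 X := fun p t ht h =>
    hmiss t ht (Set.mem_iUnion.2 ⟨p, h⟩)
  obtain ⟨f, hf0, hfu, hXf⟩ := hX
  obtain ⟨n₀, hn₀, hmax⟩ := Finset.exists_max_image f.coeff.support (fun n => pairing n v)
    (Finsupp.support_nonempty_iff.2 (by simpa using hf0))
  have hvertex : ∀ n ∈ f.coeff.support, n ≠ n₀ → pairing n v < pairing n₀ v := by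
    intro n₁ hn₁ hne
    by_contra! hle
    have heq : pairing n₁ v = pairing n₀ v := le_antisymm (hmax n₁ hn₁) hle
    -- Where all coefficients have norm 1 the tropical polynomial is max ⟨n, ·⟩, so a second
    -- maximizing exponent would put `v` itself in the amoeba.
    obtain ⟨w, hw, hw', hwC, hwT⟩ := exists_norm_eq_one hF (f.coeff.support.image f.coeff)
    obtain ⟨p, hp⟩ := exists_place_isEquiv hrep hw' hwC
    have hone : ∀ n ∈ f.coeff.support, Real.log ((rep p).1 (f.coeff n)) = 0 := fun n hn => by
      rw [hp.eq_one_iff.2 (hwT _ (Finset.mem_image_of_mem _ hn) (Finsupp.mem_support_iff.1 hn)),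
        Real.log_one]
    refine hray p 1 one_pos ?_
    rw [one_smul, hXf]
    exact mem_amoebaAt_of_max_attained_twice (isNonarchimedean_of_isEquiv hp hw) (rep p).2.1 f v
      (pairing n₀ v) (fun n hn => by rw [hone n hn, zero_add]; exact hmax n hn) hn₀ hn₁ hne.symm
      (by rw [hone n₀ hn₀, zero_add]) (by rw [hone n₁ hn₁, zero_add, heq])
  obtain ⟨n₁, hn₁, hn₁₀⟩ := exists_ne_mem_support hfu hn₀
  obtain ⟨g, hgf, hg0, hgS⟩ := exists_normalized_equation hn₀
  have hXg : X = Ideal.span {g} := hXf.trans hgf.symm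
  have hgv : ∀ n ∈ g.coeff.support, n ≠ 0 → pairing n v < 0 := fun n hn hn0 => by
    have h1 := hvertex (n + n₀) ((hgS n).1 hn) (by simpa using hn0)
    have h2 := pairing_sub_left (n + n₀) n₀ v
    rw [add_sub_cancel_right] at h2
    linarith
  have hgne : n₁ - n₀ ∈ g.coeff.support := (hgS _).2 (by simpa using hn₁)
  have hgne0 : n₁ - n₀ ≠ 0 := sub_ne_zero.2 hn₁₀
  have hle : ∀ p, IsNonarchimedean (rep p).1 → ∀ n ∈ g.coeff.support, (rep p).1 (g.coeff n) ≤ 1 :=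
    fun p hp => apply_coeff_le_one_of_ray_disjoint hp (rep p).2.1 hg0 hgv
      (fun t ht => hXg ▸ hray p t ht)
  obtain ⟨p₀, hp₀⟩ := h0
  rcases hF with ⟨hnf, hC⟩ | ⟨K, rfl, -, hK⟩
  · have hint : ∀ n ∈ g.coeff.support, IsIntegral ℤ (g.coeff n) := fun n hn =>
      isIntegral_of_forall_nonarchimedean fun w hw hw' => by
        obtain ⟨p, hp⟩ := exists_place_isEquiv hrep hw' (by simp [hC])
        exact hp.le_one_iff.1 (hle p (isNonarchimedean_of_isEquiv hp hw) n hn)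
    obtain ⟨z, hz, htors⟩ := exists_torsion_point hg0 hgv ⟨_, hgne, hgne0⟩ hint
      fun σ t ht => zeroFreeAt_of_ray_disjoint hC hrep hXg hray σ ht
    exact hp₀ (hXg ▸ zero_mem_amoebaAt_of_torsion_point (rep p₀).1 g z hz htors)
  · have htriv : ∀ a ∈ K, a ≠ 0 → (rep p₀).1 a = 1 := (rep p₀).2.2
    have hna := isNonarchimedean_of_trivial_on_subfield htriv
    set b := g.coeff (n₁ - n₀) with hb
    have hb0 : b ≠ 0 := Finsupp.mem_support_iff.1 hgne
    have hlt : (rep p₀).1 b < 1 := by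
      -- If |b| = 1, then b ties with the constant term at the origin, where no term is larger, and
      -- 0 lies in the amoeba.
      refine lt_of_le_of_ne (hle p₀ hna _ hgne) fun heq => hp₀ ?_
      rw [hXg]
      refine mem_amoebaAt_of_max_attained_twice hna (rep p₀).2.1 g 0 0 (fun n hn => ?_)
        (n₀ := 0) (by simp [hg0]) hgne hgne0.symm (by simp [hg0]) (by simp [← hb, heq])
      rw [pairing_zero_right, add_zero]
      exact Real.log_nonpos ((rep p₀).1.nonneg _) (hle p₀ hna n hn)
    have htr : Transcendental K b⁻¹ := fun h =>
      transcendental_of_lt_one hna htriv hb0 hlt (by simpa using h.inv)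
    -- A zero of b⁻¹ is a pole of b, against |b| ≤ 1 at every nonarchimedean place.
    obtain ⟨w, hw, hw', hwK, hwb⟩ := exists_absoluteValue_lt_one hK htr
    obtain ⟨p, hp⟩ := exists_place_isEquiv hrep hw' hwK
    have h1 := hp.le_one_iff.1 (hle p (isNonarchimedean_of_isEquiv hp hw) _ hgne)
    rw [map_inv₀, inv_lt_one₀ (w.pos hb0)] at hwb
    exact absurd h1 (not_le.2 hwb)
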